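/- **Setting.** A nice Young function is an even, continuous, convex function $\Phi:\mathbb R\to[0,\infty)$ with $\Phi(x)=0$ iff $x=0$, $\Phi(x)/x\to0$ as $x\to0^+$ and $\Phi(x)/x\to\infty$ as $x\to\infty$. For a probability measure $\mu$ on $\mathbb R^n$ and a $\mu$-a.e. measurable $f:\mathbb R^n\to\mathbb R$ put $\|f\|_\Phi=\inf\{a>0:\int\Phi(|f|/a)\,d\mu\le1\}\in[0,\infty]$ (with $\inf\emptyset=\infty$) and let $\mathbb L_\Phi$ be the set of $f$ with $\|f\|_\Phi<\infty$. Let $F:(0,\infty)\to\mathbb R$ be $\mathcal C^2$ and non-decreasing, with $F(1)=0$ and $F(x)\ne0$ for $x\neq1$, such that $x\mapsto xF(x)$ is convex and $1/(xF(x))$ is not integrable near $0^+$, near $1^-$, near $1^+$ and near $+\infty$. Let $\mathcal F_1$ on $(0,1)$ and $\mathcal F_2$ on $(1,\infty)$ be primitives of $1/(xF(x))$. Let $\Phi_0$ be a nice Young function of class $\mathcal C^2$ on $(0,\infty)$ such that $-(\Phi_0/\Phi_0')'F(\Phi_0)-\Phi_0F'(\Phi_0)$ is non-increasing on $(0,\infty)$,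 let $x_o>0$ be the point with $\Phi_0(x_o)=1$, and let $\lambda:[0,\infty)\to[0,\infty)$ be non-decreasing with $\lambda(0)=0$. The standard Orlicz family built from $F,\Phi_0,\lambda$ is the family $(\Phi_t)_{t\ge0}$ of even functions with $\Phi_t(0)=0$, $\Phi_t(x_o)=1$, $\Phi_t(x)=\mathcal F_1^{-1}(\mathcal F_1(\Phi_0(x))+\lambda(t))$ for $0<x<x_o$ and $\Phi_t(x)=\mathcal F_2^{-1}(\mathcal F_2(\Phi_0(x))+\lambda(t))$ for $x>x_o$. **Theorem.** Let $V:\mathbb R^n\to\mathbb R$ be $\mathcal C^2$ with $\int e^{-V}dx=1$, let $\mu(dx)=e^{-V(x)}dx$, and let $(P_t)_{t\ge0}$ be the Markov semigroup associated with $L=\Delta-\nabla V\cdot\nabla$: the semigroup of Markov kernels on $\mathbb R^n$, reversible for $\mu$, whose generator in $L^2(\mu)$ is the closure of $L$ on $\mathcal C_c^\infty(\mathbb R^n)$. All Luxembourg norms are taken with respect to $\mu$. Let $(\Phi_t)_{t\ge0}$ and $(\Psi_t)_{t\ge0}$ be the standard Orlicz families built from $F,\Phi_0,\lambda$ and from $\widetilde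 F,\Phi_0,\lambda$ respectively, where $F$ and $\widetilde F$ both satisfy the above assumptions with the same $\Phi_0$ and $\lambda$. Assume moreover that $\lambda$ is differentiable on $[0,\infty)$ (one-sidedly at $0$) with $\lambda'(0)>0$. Assume that for every $\varepsilon>0$ there is $D(\varepsilon)\ge0$ with $$\widetilde F(x)\le\varepsilon F(x)+D(\varepsilon)\qquad\text{for all }x>0,$$ and that $\|P_tf\|_{\Phi_t}\le\|f\|_{\Phi_0}$ for all $f\in\mathbb L_{\Phi_0}$ and $t\ge0$. Then for all $s_2\ge s_1\ge0$, all $t\ge0$, every non-decreasing $\mathcal C^1$ function $q:[0,\infty)\to[0,\infty)$ with $q(0)=s_1$ and $q(t)=s_2$, and every $f\in\mathbb L_{\Psi_{s_1}}$, $$\|P_tf\|_{\Psi_{s_2}}\le\|f\|_{\Psi_{s_1}}\exp\left\{\int_0^tq'(u)\lambda'(q(u))\,D\!\left(\frac{\lambda'(0)}{q'(u)\lambda'(q(u))}\right)du\right\}.$$ Here the integrand is $0$ where $q'(u)\lambda'(q(u))=0$. The integral of this nonnegative function takes values in $[0,\infty]$; since $D$ need not be measurable, it is the lower Lebesgue integral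 (the supremum of the integrals of measurable functions below the integrand), which is the usual integral when the integrand is measurable. Also $e^\infty=\infty$ and $0\cdot\infty=0$. -/

import Mathlib

open Set Filter Topology MeasureTheory ProbabilityTheory
open scoped ENNReal NNReal ContDiff

noncomputable section

namespace OrliczHyp

/-! ### Orlicz functions and Luxembourg norms -/

/-- Nice Young functions (N-functions): even, continuous, convex, vanishing exactly at `0`,
sublinear at `0` and superlinear at infinity.  (Nonnegativity is a consequence.) -/
structure IsNiceYoung (Φ : ℝ → ℝ) : Prop where
  even : ∀ x, Φ (-x) = Φ x
  continuous : Continuous Φ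
  convex : ConvexOn ℝ univ Φ
  eq_zero_iff : ∀ x, Φ x = 0 ↔ x = 0
  tendsto_zero : Tendsto (fun x => Φ x / x) (𝓝[>] 0) (𝓝 0)
  tendsto_atTop : Tendsto (fun x => Φ x / x) atTop atTop

/-- The Luxembourg norm `inf {a > 0 : ∫ Φ(|f|/a) dμ ≤ 1}`, with `inf ∅ = ∞`. -/
def luxNorm {E : Type*} [MeasurableSpace E] (μ : Measure E) (Φ : ℝ → ℝ) (f : E → ℝ) : ℝ≥0∞ :=
  sInf {b : ℝ≥0∞ | ∃ a : ℝ, 0 < a ∧ b = ENNReal.ofReal a ∧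
    ∫⁻ x, ENNReal.ofReal (Φ (|f x| / a)) ∂μ ≤ 1}

/-- Membership in the Orlicz space of `Φ` and `μ`. -/
def MemOrlicz {E : Type*} [MeasurableSpace E] (μ : Measure E) (Φ : ℝ → ℝ) (f : E → ℝ) : Prop :=
  AEMeasurable f μ ∧ luxNorm μ Φ f < ⊤

/-! ### Standard Orlicz families -/

/-- The assumptions on `F`, `Φ₀` and `lam` under which the standard Orlicz family is defined.
Only the values of `F` on `(0, ∞)` and those of `lam` on `[0, ∞)` matter. -/
structure IsStandardData (F Φ₀ lam : ℝ → ℝ) : Prop where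
  F_contDiff : ContDiffOn ℝ 2 F (Ioi 0)
  F_mono : MonotoneOn F (Ioi 0)
  /-- `F 1 = 0`, and `1/(x F(x))` is meaningful on `(0,1)` and on `(1,∞)`; the second part is
  automatic when `F` is strictly increasing. -/
  F_eq_zero_iff : ∀ x, 0 < x → (F x = 0 ↔ x = 1)
  F_convex : ConvexOn ℝ (Ioi 0) (fun x => x * F x)
  F_not_int_zero : ¬ IntegrableAtFilter (fun x : ℝ => 1 / (x * F x)) (𝓝[>] 0)
  F_not_int_one_left : ¬ IntegrableAtFilter (fun x : ℝ => 1 / (x * F x)) (𝓝[<] 1)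
  F_not_int_one_right : ¬ IntegrableAtFilter (fun x : ℝ => 1 / (x * F x)) (𝓝[>] 1)
  F_not_int_top : ¬ IntegrableAtFilter (fun x : ℝ => 1 / (x * F x)) atTop
  young : IsNiceYoung Φ₀
  Φ₀_contDiff : ContDiffOn ℝ 2 Φ₀ (Ioi 0)
  antitone : AntitoneOn (fun x => -(deriv (fun y => Φ₀ y / deriv Φ₀ y) x) * F (Φ₀ x)
    - Φ₀ x * deriv F (Φ₀ x)) (Ioi 0)
  lam_mono : MonotoneOn lam (Ici 0)
  lam_zero : lam 0 = 0

/-- The primitive of `1/(y F(y))` that vanishes at `c`; it is used on `(0,1)` with `c = 1/2` and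
on `(1,∞)` with `c = 2`. -/
def primInv (F : ℝ → ℝ) (c x : ℝ) : ℝ := ∫ y in c..x, 1 / (y * F y)

/-- The standard Orlicz family `Φ_t` built from `F`, `Φ₀` and `lam`.  As `Φ₀` is even, vanishes
only at `0` and increases on `[0,∞)`, the four cases are `x = 0`, `0 < |x| < x₀`, `|x| = x₀` and
`|x| > x₀`, where `x₀` is the positive point at which `Φ₀` equals `1`. -/
def stdOrlicz (F Φ₀ lam : ℝ → ℝ) (t x : ℝ) : ℝ :=
  if Φ₀ x = 0 then 0
  else if Φ₀ x < 1 then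
    Function.invFunOn (primInv F (1 / 2)) (Ioo 0 1) (primInv F (1 / 2) (Φ₀ x) + lam t)
  else if Φ₀ x = 1 then 1
  else Function.invFunOn (primInv F 2) (Ioi 1) (primInv F 2 (Φ₀ x) + lam t)

/-! ### The diffusion semigroup with generator `Δ - ∇V · ∇` -/

/-- The measure `e^{-V} dx`. -/
def gibbs {n : ℕ} (V : EuclideanSpace ℝ (Fin n) → ℝ) : Measure (EuclideanSpace ℝ (Fin n)) :=
  volume.withDensity (fun x => ENNReal.ofReal (Real.exp (-V x)))

/-- The operator `L φ = Δφ - ∇V · ∇φ`. -/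
def genL {n : ℕ} (V φ : EuclideanSpace ℝ (Fin n) → ℝ) (x : EuclideanSpace ℝ (Fin n)) : ℝ :=
  Laplacian.laplacian φ x - inner ℝ (gradient V x) (gradient φ x)

/-- The action `P f (x) = ∫ f(y) P(x,dy)` of a kernel on functions. -/
def act {E : Type*} [MeasurableSpace E] (κ : Kernel E E) (f : E → ℝ) (x : E) : ℝ :=
  ∫ y, f y ∂(κ x)

/-- `(g, h)` lies in the graph of the generator of `P` in `L²(μ)`:
`(P_t g - g)/t → h` in `L²(μ)` as `t → 0⁺`. -/
def InGeneratorGraph {E : Type*} [MeasurableSpace E] (μ : Measure E) (P : ℝ≥0 → Kernel E E)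
    (g h : E → ℝ) : Prop :=
  Tendsto (fun t : ℝ≥0 => eLpNorm (fun x => (act (P t) g x - g x) / (t : ℝ) - h x) 2 μ)
    (𝓝[>] 0) (𝓝 0)

/-- `(g, h)` lies in the closure in `L²(μ) × L²(μ)` of the graph of `L = Δ - ∇V · ∇` on smooth
compactly supported functions. -/
def InClosureGraph {n : ℕ} (V : EuclideanSpace ℝ (Fin n) → ℝ)
    (g h : EuclideanSpace ℝ (Fin n) → ℝ) : Prop :=
  ∃ φ : ℕ → EuclideanSpace ℝ (Fin n) → ℝ,
    (∀ k, ContDiff ℝ ∞ (φ k) ∧ HasCompactSupport (φ k)) ∧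
    Tendsto (fun k => eLpNorm (fun x => φ k x - g x) 2 (gibbs V)) atTop (𝓝 0) ∧
    Tendsto (fun k => eLpNorm (fun x => genL V (φ k) x - h x) 2 (gibbs V)) atTop (𝓝 0)

/-- `P` is the Markov semigroup associated with `L = Δ - ∇V · ∇`: a semigroup of Markov kernels,
reversible for `e^{-V} dx`, whose generator in `L²(e^{-V} dx)` is the closure of `L` on smooth
compactly supported functions. -/
structure IsDiffusionSemigroup {n : ℕ} (V : EuclideanSpace ℝ (Fin n) → ℝ)
    (P : ℝ≥0 → Kernel (EuclideanSpace ℝ (Fin n)) (EuclideanSpace ℝ (Fin n))) : Prop where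
  markov : ∀ t, IsMarkovKernel (P t)
  zero : P 0 = Kernel.id
  add : ∀ s t, P (s + t) = P s ∘ₖ P t
  reversible : ∀ t, Kernel.IsReversible (P t) (gibbs V)
  generator : ∀ g h, MemLp g 2 (gibbs V) → MemLp h 2 (gibbs V) →
    (InGeneratorGraph (gibbs V) P g h ↔ InClosureGraph V g h)

end OrliczHyp

end

/-! Write `T_θ` and `T̃_θ` for the flows of `y' = y F(y)` and `y' = y F̃(y)`. Then `Φ_t = T_{λ(t)} ∘
Φ₀` and `Ψ_t = T̃_{λ(t)} ∘ Φ₀`, so moving along an Orlicz family means running a scalar ODE.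

Two comparison facts carry the proof. First, `ρ_θ = Φ₀⁻¹ ∘ T̃_θ ∘ Φ₀` is the flow of the field
`(Φ₀/Φ₀') F̃(Φ₀)`, which is convex by the monotonicity assumption on `F̃` and `Φ₀`. Hence `ρ_θ` is
convex (`convexOn_reparam`), and Jensen gives `ρ_θ(|Pf|) ≤ P ρ_θ(|f|)`. Second, if `F̃ ≤ ε F + d`,
then `T̃_{θ+r}(Φ₀(e^{-dr} x)) ≤ T_{εr}(T̃_θ(Φ₀ x))` (`flow_young_exp_le`).

Together they transfer the hypothesis, which concerns only the starting function `Φ₀`, to every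
level `θ`: applied to `g = ρ_θ(|f|/a)`, it shows that a time `τ` with `λ(τ) = ε r` raises the level
of the second family from `θ` to `θ + r` at the price `e^{dr}` (`lintegral_flow_act_le_one`).
Splitting into `N` small steps, where `λ(τ) ≈ λ'(0) τ`, raises the level by `r` in total time `t`
whenever `ε r < λ'(0) t` (`luxNorm_act_le_mul_exp`).

It remains to compare prices. With `r = λ(s₂) - λ(s₁)`, the exponent obtained is `r K(λ'(0) t / r)`,
where `K ≤ D` is the convex antitone function `defect`. Since `r` is the integral of `g = (λ ∘ q)'`
over `[0, t]`, Jensen for the perspective `g K(c/g)` bounds this exponent by the stated integral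
(`ofReal_mul_le_lintegral`). -/

noncomputable section

namespace OrliczHyp

/-! ### The flow of `y' = y F(y)` -/

/-- The time-`θ` flow of the equation `y' = y F(y)` on `[0, ∞)`. -/
def flow (F : ℝ → ℝ) (θ y : ℝ) : ℝ :=
  if y = 0 then 0
  else if y < 1 then
    Function.invFunOn (primInv F (1 / 2)) (Ioo 0 1) (primInv F (1 / 2) y + θ)
  else if y = 1 then 1
  else Function.invFunOn (primInv F 2) (Ioi 1) (primInv F 2 y + θ)

theorem stdOrlicz_eq_flow (F Φ₀ lam : ℝ → ℝ) (t x : ℝ) :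
    stdOrlicz F Φ₀ lam t x = flow F (lam t) (Φ₀ x) := rfl

/-- The derivative of `Function.invFunOn` at a regular value. -/
theorem hasDerivAt_invFunOn {G : ℝ → ℝ} {I : Set ℝ} {z g : ℝ} (hI : I ∈ 𝓝 z) (hinj : InjOn G I)
    (hG : HasStrictDerivAt G g z) (hg : g ≠ 0) :
    HasDerivAt (Function.invFunOn G I) g⁻¹ (G z) := by
  have h1 := hG.to_localInverse hg
  have h2 := (hG.hasStrictFDerivAt_equiv hg).eventually_right_inverse
  have h3 : hG.localInverse G g z hg (G z) = z :=
    (hG.hasStrictFDerivAt_equiv hg).localInverse_apply_image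
  have h4 : ∀ᶠ y in 𝓝 (G z), hG.localInverse G g z hg y ∈ I := by
    apply h1.hasDerivAt.continuousAt.eventually_mem
    rwa [h3]
  -- Near `G z` the local inverse takes values in `I`, where injectivity forces it to agree with the
  -- globally chosen inverse.
  refine h1.hasDerivAt.congr_of_eventuallyEq ?_
  filter_upwards [h2, h4] with y hy hyI
  have hex : ∃ a ∈ I, G a = y := ⟨_, hyI, hy⟩
  exact hinj (Function.invFunOn_mem hex) hyI ((Function.invFunOn_eq hex).trans hy.symm)

theorem hasStrictDerivAt_primInv {F : ℝ → ℝ} {I : Set ℝ} {c z : ℝ} (hI : IsOpen I)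
    (hoc : OrdConnected I) (hc : c ∈ I) (hz : z ∈ I)
    (hcont : ContinuousOn (fun y => 1 / (y * F y)) I) :
    HasStrictDerivAt (primInv F c) (1 / (z * F z)) z := by
  refine intervalIntegral.integral_hasStrictDerivAt_right (f := fun y => 1 / (y * F y)) ?_ ?_ ?_
  · exact (hcont.mono (hoc.uIcc_subset hc hz)).intervalIntegrable
  · exact hcont.stronglyMeasurableAtFilter hI z hz
  · exact hcont.continuousAt (hI.mem_nhds hz)

section Flow

variable {F Φ₀ lam : ℝ → ℝ}

namespace IsStandardData

theorem F_neg (h : IsStandardData F Φ₀ lam) {x : ℝ} (h0 : 0 < x) (h1 : x < 1) : F x < 0 := by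
  have h2 : F x ≤ F 1 := h.F_mono h0 (mem_Ioi.2 one_pos) h1.le
  rw [(h.F_eq_zero_iff 1 one_pos).2 rfl] at h2
  exact lt_of_le_of_ne h2 fun h3 => h1.ne ((h.F_eq_zero_iff x h0).1 h3)

theorem F_pos (h : IsStandardData F Φ₀ lam) {x : ℝ} (h1 : 1 < x) : 0 < F x := by
  have h0 : 0 < x := one_pos.trans h1
  have h2 : F 1 ≤ F x := h.F_mono (mem_Ioi.2 one_pos) h0 h1.le
  rw [(h.F_eq_zero_iff 1 one_pos).2 rfl] at h2
  exact lt_of_le_of_ne h2 fun h3 => h1.ne' ((h.F_eq_zero_iff x h0).1 h3.symm)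

theorem continuousOn_inv (h : IsStandardData F Φ₀ lam) {I : Set ℝ} (hI : ∀ x ∈ I, 0 < x ∧ x ≠ 1) :
    ContinuousOn (fun y => 1 / (y * F y)) I := by
  refine continuousOn_const.div (continuousOn_id.mul (h.F_contDiff.continuousOn.mono
    fun x hx => (hI x hx).1)) fun x hx => ?_
  exact mul_ne_zero (hI x hx).1.ne' fun h0 => (hI x hx).2 ((h.F_eq_zero_iff x (hI x hx).1).1 h0)

theorem hasStrictDerivAt_left (h : IsStandardData F Φ₀ lam) {z : ℝ} (hz : z ∈ Ioo (0 : ℝ) 1) :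
    HasStrictDerivAt (primInv F (1 / 2)) (1 / (z * F z)) z :=
  hasStrictDerivAt_primInv isOpen_Ioo ordConnected_Ioo (by norm_num) hz
    (h.continuousOn_inv fun _ hx => ⟨hx.1, hx.2.ne⟩)

theorem hasStrictDerivAt_right (h : IsStandardData F Φ₀ lam) {z : ℝ} (hz : z ∈ Ioi (1 : ℝ)) :
    HasStrictDerivAt (primInv F 2) (1 / (z * F z)) z :=
  hasStrictDerivAt_primInv isOpen_Ioi ordConnected_Ioi (by norm_num) hz
    (h.continuousOn_inv fun _ hx => ⟨one_pos.trans hx, (mem_Ioi.1 hx).ne'⟩)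

theorem strictAntiOn_left (h : IsStandardData F Φ₀ lam) :
    StrictAntiOn (primInv F (1 / 2)) (Ioo 0 1) := by
  refine strictAntiOn_of_deriv_neg (convex_Ioo _ _)
    (fun z hz => (h.hasStrictDerivAt_left hz).hasDerivAt.continuousAt.continuousWithinAt) ?_
  intro z hz
  rw [interior_Ioo] at hz
  rw [(h.hasStrictDerivAt_left hz).hasDerivAt.deriv]
  exact one_div_neg.2 (mul_neg_of_pos_of_neg hz.1 (h.F_neg hz.1 hz.2))

theorem strictMonoOn_right (h : IsStandardData F Φ₀ lam) :
    StrictMonoOn (primInv F 2) (Ioi 1) := by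
  refine strictMonoOn_of_deriv_pos (convex_Ioi _)
    (fun z hz => (h.hasStrictDerivAt_right hz).hasDerivAt.continuousAt.continuousWithinAt) ?_
  intro z hz
  rw [interior_Ioi] at hz
  rw [(h.hasStrictDerivAt_right hz).hasDerivAt.deriv]
  exact one_div_pos.2 (mul_pos (one_pos.trans hz) (h.F_pos hz))

/-- The integrand is negative on `(0,1)` and not integrable at `0`, so the primitive based at `1/2`
is unbounded above near `0`. Thus the forward flow exists for all time without leaving `(0,1)`. -/
theorem exists_left (h : IsStandardData F Φ₀ lam) {y θ : ℝ} (hy : y ∈ Ioo (0 : ℝ) 1) (hθ : 0 ≤ θ) :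
    ∃ z ∈ Ioo (0 : ℝ) 1, primInv F (1 / 2) z = primInv F (1 / 2) y + θ := by
  have hcont : ContinuousOn (primInv F (1 / 2)) (Ioo 0 1) :=
    fun z hz => (h.hasStrictDerivAt_left hz).hasDerivAt.continuousAt.continuousWithinAt
  have hbig : ∃ z ∈ Ioo 0 y, primInv F (1 / 2) y + θ ≤ primInv F (1 / 2) z := by
    by_contra! hno
    apply h.F_not_int_zero
    refine ⟨Ioc 0 (1 / 2), Ioc_mem_nhdsGT (by norm_num), ?_⟩
    obtain ⟨a, ha, ha0⟩ : ∃ a : ℕ → ℝ, (∀ k, a k ∈ Ioo 0 (min y (1 / 2))) ∧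
        Tendsto a atTop (𝓝 0) := by
      have hm : 0 < min y (1 / 2) := lt_min hy.1 (by norm_num)
      obtain ⟨u, -, hu, hu0⟩ := exists_seq_strictAnti_tendsto' hm
      exact ⟨u, hu, hu0⟩
    have hint : ∀ k, IntervalIntegrable (fun x : ℝ => 1 / (x * F x)) volume (a k) (1 / 2) := by
      intro k
      have h1 := ha k
      refine ((h.continuousOn_inv (I := Ioo 0 1)
        fun _ hx => ⟨hx.1, hx.2.ne⟩).mono ?_).intervalIntegrable
      refine ordConnected_Ioo.uIcc_subset ⟨h1.1, ?_⟩ (by norm_num)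
      exact h1.2.trans_le ((min_le_right _ _).trans (by norm_num))
    refine integrableOn_Ioc_of_intervalIntegral_norm_bounded_left (l := atTop) (a := a)
      (I := primInv F (1 / 2) y + θ) ?_ ha0 ?_
    · exact fun k => (hint k).1
    · refine Eventually.of_forall fun k => ?_
      have h1 := ha k
      have hk : a k ≤ 1 / 2 := (h1.2.trans_le (min_le_right _ _)).le
      have h2 : ∫ x in Ioc (a k) (1 / 2), ‖1 / (x * F x)‖ = primInv F (1 / 2) (a k) := by
        rw [primInv, intervalIntegral.integral_symm, intervalIntegral.integral_of_le hk,
          ← integral_neg]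
        refine setIntegral_congr_fun measurableSet_Ioc fun x hx => ?_
        have hx0 : 0 < x := h1.1.trans hx.1
        have hx1 : x < 1 := hx.2.trans_lt (by norm_num)
        exact Real.norm_of_nonpos
          (one_div_neg.2 (mul_neg_of_pos_of_neg hx0 (h.F_neg hx0 hx1))).le
      rw [h2]
      exact (hno _ ⟨h1.1, h1.2.trans_le (min_le_left _ _)⟩).le
  obtain ⟨z, hz, hzb⟩ := hbig
  have hsub : Icc z y ⊆ Ioo 0 1 := fun x hx => ⟨hz.1.trans_le hx.1, hx.2.trans_lt hy.2⟩
  obtain ⟨w, hw, hwe⟩ := intermediate_value_Icc' hz.2.le (hcont.mono hsub)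
    ⟨le_add_of_nonneg_right hθ, hzb⟩
  exact ⟨w, hsub hw, hwe⟩

theorem exists_right (h : IsStandardData F Φ₀ lam) {y θ : ℝ} (hy : y ∈ Ioi (1 : ℝ)) (hθ : 0 ≤ θ) :
    ∃ z ∈ Ioi (1 : ℝ), primInv F 2 z = primInv F 2 y + θ := by
  have hy1 : 1 < y := hy
  have hcont : ContinuousOn (primInv F 2) (Ioi 1) :=
    fun z hz => (h.hasStrictDerivAt_right hz).hasDerivAt.continuousAt.continuousWithinAt
  have hbig : ∃ z ∈ Ioi y, primInv F 2 y + θ ≤ primInv F 2 z := by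
    by_contra! hno
    apply h.F_not_int_top
    refine ⟨Ioi 2, Ioi_mem_atTop 2, ?_⟩
    set b : ℕ → ℝ := fun k => max y 2 + (k + 1) with hb
    have hbk : ∀ k, y < b k ∧ 2 < b k := by
      intro k
      have h1 := le_max_left y 2
      have h2 := le_max_right y 2
      have h3 : (0 : ℝ) ≤ k := k.cast_nonneg
      constructor <;> simp only [hb] <;> linarith
    have hbt : Tendsto b atTop atTop :=
      tendsto_atTop_add_const_left _ _ (tendsto_atTop_add_const_right _ _
        tendsto_natCast_atTop_atTop)
    have hint : ∀ k, IntervalIntegrable (fun x : ℝ => 1 / (x * F x)) volume 2 (b k) := by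
      intro k
      refine ((h.continuousOn_inv (I := Ioi 1)
        fun _ hx => ⟨one_pos.trans hx, (mem_Ioi.1 hx).ne'⟩).mono ?_).intervalIntegrable
      exact ordConnected_Ioi.uIcc_subset (by norm_num) (hy1.trans (hbk k).1)
    refine integrableOn_Ioi_of_intervalIntegral_norm_bounded (l := atTop) (b := b)
      (primInv F 2 y + θ) 2 (fun k => (hint k).1) hbt ?_
    refine Eventually.of_forall fun k => ?_
    have h2 : ∫ x in (2 : ℝ)..b k, ‖1 / (x * F x)‖ = primInv F 2 (b k) := by
      rw [primInv, intervalIntegral.integral_of_le (hbk k).2.le,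
        intervalIntegral.integral_of_le (hbk k).2.le]
      refine setIntegral_congr_fun measurableSet_Ioc fun x hx => ?_
      have hx1 : 1 < x := one_lt_two.trans hx.1
      exact Real.norm_of_nonneg (one_div_pos.2 (mul_pos (one_pos.trans hx1) (h.F_pos hx1))).le
    rw [h2]
    exact (hno _ (hbk k).1).le
  obtain ⟨z, hz, hzb⟩ := hbig
  have hsub : Icc y z ⊆ Ioi 1 := fun x hx => hy1.trans_le hx.1
  obtain ⟨w, hw, hwe⟩ := intermediate_value_Icc (mem_Ioi.1 hz).le (hcont.mono hsub)
    ⟨le_add_of_nonneg_right hθ, hzb⟩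
  exact ⟨w, hsub hw, hwe⟩

end IsStandardData

theorem flow_zero_right (F : ℝ → ℝ) (θ : ℝ) : flow F θ 0 = 0 := by simp [flow]

theorem flow_one_right (F : ℝ → ℝ) (θ : ℝ) : flow F θ 1 = 1 := by simp [flow]

theorem flow_of_lt_one {y : ℝ} (θ : ℝ) (hy : y ∈ Ioo (0 : ℝ) 1) : flow F θ y =
    Function.invFunOn (primInv F (1 / 2)) (Ioo 0 1) (primInv F (1 / 2) y + θ) := by
  simp only [flow, hy.1.ne', hy.2, if_true, if_false]

theorem flow_of_one_lt {y : ℝ} (θ : ℝ) (hy : 1 < y) : flow F θ y =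
    Function.invFunOn (primInv F 2) (Ioi 1) (primInv F 2 y + θ) := by
  simp only [flow, (one_pos.trans hy).ne', hy.not_gt, hy.ne', if_false]

namespace IsStandardData

theorem flow_left (h : IsStandardData F Φ₀ lam) {y θ : ℝ} (hy : y ∈ Ioo (0 : ℝ) 1) (hθ : 0 ≤ θ) :
    flow F θ y ∈ Ioo (0 : ℝ) 1 ∧
      primInv F (1 / 2) (flow F θ y) = primInv F (1 / 2) y + θ := by
  rw [flow_of_lt_one θ hy]
  exact ⟨Function.invFunOn_mem (h.exists_left hy hθ), Function.invFunOn_eq (h.exists_left hy hθ)⟩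

theorem flow_right (h : IsStandardData F Φ₀ lam) {y θ : ℝ} (hy : 1 < y) (hθ : 0 ≤ θ) :
    1 < flow F θ y ∧ primInv F 2 (flow F θ y) = primInv F 2 y + θ := by
  rw [flow_of_one_lt θ hy]
  exact ⟨Function.invFunOn_mem (h.exists_right hy hθ),
    Function.invFunOn_eq (h.exists_right hy hθ)⟩

theorem flow_pos (h : IsStandardData F Φ₀ lam) {y θ : ℝ} (hy : 0 < y) (hθ : 0 ≤ θ) :
    0 < flow F θ y := by
  rcases lt_trichotomy y 1 with h1 | rfl | h1
  · exact (h.flow_left ⟨hy, h1⟩ hθ).1.1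
  · rw [flow_one_right]; exact one_pos
  · exact one_pos.trans (h.flow_right h1 hθ).1

theorem flow_le (h : IsStandardData F Φ₀ lam) {y θ : ℝ} (hy : 0 < y) (hy1 : y ≤ 1) (hθ : 0 ≤ θ) :
    flow F θ y ≤ y := by
  rcases hy1.lt_or_eq with h1 | rfl
  · obtain ⟨h2, h3⟩ := h.flow_left ⟨hy, h1⟩ hθ
    refine (h.strictAntiOn_left.le_iff_ge ⟨hy, h1⟩ h2).1 ?_
    rw [h3]; linarith
  · rw [flow_one_right]

theorem le_flow (h : IsStandardData F Φ₀ lam) {y θ : ℝ} (hy1 : 1 ≤ y) (hθ : 0 ≤ θ) :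
    y ≤ flow F θ y := by
  rcases hy1.lt_or_eq with h1 | rfl
  · obtain ⟨h2, h3⟩ := h.flow_right h1 hθ
    refine (h.strictMonoOn_right.le_iff_le h1 h2).1 ?_
    rw [h3]; linarith
  · rw [flow_one_right]

theorem flow_zero_left (h : IsStandardData F Φ₀ lam) {y : ℝ} (hy : 0 ≤ y) : flow F 0 y = y := by
  rcases hy.eq_or_lt with rfl | hy
  · exact flow_zero_right _ _
  rcases lt_trichotomy y 1 with h1 | rfl | h1
  · obtain ⟨h2, h3⟩ := h.flow_left ⟨hy, h1⟩ le_rfl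
    exact h.strictAntiOn_left.injOn h2 ⟨hy, h1⟩ (by rw [h3, add_zero])
  · exact flow_one_right _ _
  · obtain ⟨h2, h3⟩ := h.flow_right h1 le_rfl
    exact h.strictMonoOn_right.injOn h2 h1 (by rw [h3, add_zero])

theorem flow_mono (h : IsStandardData F Φ₀ lam) {θ : ℝ} (hθ : 0 ≤ θ) :
    MonotoneOn (flow F θ) (Ici 0) := by
  intro y hy y' hy' hle
  rcases (mem_Ici.1 hy).eq_or_lt with rfl | hy
  · rw [flow_zero_right]
    rcases hle.eq_or_lt with rfl | h0
    · rw [flow_zero_right]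
    · exact (h.flow_pos h0 hθ).le
  have hy' : 0 < y' := hy.trans_le hle
  rcases lt_or_ge y' 1 with h1 | h1
  · obtain ⟨h2, h3⟩ := h.flow_left ⟨hy, hle.trans_lt h1⟩ hθ
    obtain ⟨h4, h5⟩ := h.flow_left ⟨hy', h1⟩ hθ
    refine (h.strictAntiOn_left.le_iff_ge h4 h2).1 ?_
    rw [h3, h5]
    exact add_le_add_left (h.strictAntiOn_left.antitoneOn ⟨hy, hle.trans_lt h1⟩ ⟨hy', h1⟩ hle) _
  rcases le_or_gt y 1 with h2 | h2
  · exact (h.flow_le hy h2 hθ).trans (h2.trans (h1.trans (h.le_flow h1 hθ)))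
  · obtain ⟨h3, h4⟩ := h.flow_right h2 hθ
    obtain ⟨h5, h6⟩ := h.flow_right (h2.trans_le hle) hθ
    refine (h.strictMonoOn_right.le_iff_le h3 h5).1 ?_
    rw [h4, h6]
    exact add_le_add_left (h.strictMonoOn_right.monotoneOn h2 (h2.trans_le hle) hle) _

/-- The derivative is two-sided even at `θ = 0`: the primitive is inverted on a whole neighbourhood
of the value reached. -/
theorem hasDerivAt_flow (h : IsStandardData F Φ₀ lam) {y θ : ℝ} (hy : 0 < y) (hθ : 0 ≤ θ) :
    HasDerivAt (fun θ => flow F θ y) (flow F θ y * F (flow F θ y)) θ := by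
  rcases lt_trichotomy y 1 with h1 | rfl | h1
  · obtain ⟨h2, h3⟩ := h.flow_left ⟨hy, h1⟩ hθ
    have h4 := hasDerivAt_invFunOn (Ioo_mem_nhds h2.1 h2.2) h.strictAntiOn_left.injOn
      (h.hasStrictDerivAt_left h2)
      (one_div_neg.2 (mul_neg_of_pos_of_neg h2.1 (h.F_neg h2.1 h2.2))).ne
    rw [h3, one_div (_ * _), inv_inv] at h4
    have h5 := h4.comp_const_add (primInv F (1 / 2) y) θ
    exact h5.congr_of_eventuallyEq (Eventually.of_forall fun s => flow_of_lt_one s ⟨hy, h1⟩)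
  · simp only [flow_one_right, (h.F_eq_zero_iff 1 one_pos).2 rfl, mul_zero]
    exact hasDerivAt_const _ _
  · obtain ⟨h2, h3⟩ := h.flow_right h1 hθ
    have h4 := hasDerivAt_invFunOn (Ioi_mem_nhds h2) h.strictMonoOn_right.injOn
      (h.hasStrictDerivAt_right h2) (one_div_pos.2 (mul_pos (one_pos.trans h2) (h.F_pos h2))).ne'
    rw [h3, one_div (_ * _), inv_inv] at h4
    have h5 := h4.comp_const_add (primInv F 2 y) θ
    exact h5.congr_of_eventuallyEq (Eventually.of_forall fun s => flow_of_one_lt s h1)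

end IsStandardData

end Flow

/-! ### Comparison for one-dimensional differential inequalities -/

/-- A function with the barrier property for `u' ≤ v(u)` stays below a supersolution of
`z' ≥ v(z)`, up to the exponential growth of the initial gap. -/
theorem le_add_exp_of_barrier {v u z : ℝ → ℝ} {K Θ δ : ℝ} (hΘ : 0 ≤ Θ) (hδ : 0 ≤ δ)
    (hu : ContinuousOn u (Icc 0 Θ)) (hz : ContinuousOn z (Icc 0 Θ))
    (hv : ∀ s ∈ Ico 0 Θ, z s < u s → v (u s) - v (z s) ≤ K * (u s - z s))
    (hu' : ∀ s ∈ Ico 0 Θ, ∃ p p', HasDerivWithinAt p p' (Ici s) s ∧ p s = u s ∧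
      (∀ᶠ r in 𝓝[>] s, u r ≤ p r) ∧ p' ≤ v (u s))
    (hz' : ∀ s ∈ Ico 0 Θ, ∃ z', HasDerivWithinAt z z' (Ici s) s ∧ v (z s) ≤ z')
    (h0 : u 0 ≤ z 0 + δ) : u Θ ≤ z Θ + δ * Real.exp (K * Θ) := by
  -- The extra `η` makes the barrier strict: at a contact `u - z = B`, the growth of the gap is at
  -- most `K B < (K + η) B = B'`. Then `η → 0`.
  have key : ∀ η > 0, u Θ ≤ z Θ + (δ + η) * Real.exp ((K + η) * Θ) := by
    intro η hη
    have hB : ∀ x : ℝ, HasDerivAt (fun s => (δ + η) * Real.exp ((K + η) * s))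
        ((K + η) * ((δ + η) * Real.exp ((K + η) * x))) x := by
      intro x
      have := (((hasDerivAt_id x).const_mul (K + η)).exp).const_mul (δ + η)
      refine this.congr_deriv ?_
      simp only [id, mul_one]; ring
    have hpos : ∀ x : ℝ, 0 < (δ + η) * Real.exp ((K + η) * x) := fun x => by positivity
    choose! p p' hp hps hup hp' using hu'
    choose! z' hzd hz'' using hz'
    have := image_le_of_liminf_slope_right_lt_deriv_boundary' (f := fun s => u s - z s)
      (f' := fun s => v (u s) - v (z s)) (hu.sub hz) ?_ (a := 0) (b := Θ)
      (B := fun s => (δ + η) * Real.exp ((K + η) * s))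
      (B' := fun s => (K + η) * ((δ + η) * Real.exp ((K + η) * s))) ?_
      (fun x _ => (hB x).continuousAt.continuousWithinAt) (fun x _ => (hB x).hasDerivWithinAt) ?_
      (right_mem_Icc.2 hΘ)
    · linarith
    -- As `p` touches `u` at `s` and dominates it to the right, slopes of `u - z` are at most those
    -- of `p - z`; no differentiability of `u` is needed.
    · intro s hs r hr
      apply Eventually.frequently
      have hd := (hp s hs).sub (hzd s hs)
      have hlt : p' s - z' s < r := by
        have := hp' s hs; have := hz'' s hs; linarith
      have h1 : ∀ᶠ x in 𝓝[>] s, slope (p s - z) s x < r := by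
        have := (hasDerivWithinAt_iff_tendsto_slope' self_notMem_Ioi).1 hd.Ioi_of_Ici
        exact this.eventually_lt_const hlt
      filter_upwards [h1, hup s hs, self_mem_nhdsWithin] with x hx1 hx2 hx3
      refine lt_of_le_of_lt ?_ hx1
      rw [slope_def_field, slope_def_field]
      have h3 : s < x := hx3
      apply div_le_div_of_nonneg_right _ (sub_pos.2 h3).le
      simp only [Pi.sub_apply]
      rw [hps s hs]
      linarith
    · simp only [mul_zero, Real.exp_zero, mul_one]; linarith
    · intro s hs heq
      have h1 := hpos s
      have h2 := hv s hs (by linarith)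
      rw [heq] at h2
      nlinarith
  have hlim : Tendsto (fun η => z Θ + (δ + η) * Real.exp ((K + η) * Θ)) (𝓝[>] 0)
      (𝓝 (z Θ + (δ + 0) * Real.exp ((K + 0) * Θ))) := by
    apply Tendsto.mono_left _ nhdsWithin_le_nhds
    apply Continuous.tendsto
    fun_prop
  rw [add_zero, add_zero] at hlim
  exact ge_of_tendsto hlim (eventually_mem_nhdsWithin.mono key)

/-- A convex function on `(0, ∞)` is one-sided Lipschitz on every bounded interval `(0, b]`. -/
theorem convexOn_exists_sub_le {v : ℝ → ℝ} (hv : ConvexOn ℝ (Ioi 0) v) (b : ℝ) :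
    ∃ K, 0 ≤ K ∧ ∀ x y, 0 < y → y < x → x ≤ b → v x - v y ≤ K * (x - y) := by
  by_cases hb : 0 < b
  · refine ⟨max 0 (v (b + 1) - v b), le_max_left _ _, fun x y hy hyx hxb => ?_⟩
    have hx : 0 < x := hy.trans hyx
    -- Slopes increase along `[y, x]`, `[x, b + 1]`, `[b, b + 1]`. Going beyond `b` keeps the
    -- denominators positive when `x = b`.
    have h1 := hv.slope_mono_adjacent (x := y) (y := x) (z := b + 1) hy
      (mem_Ioi.2 (by linarith)) hyx (by linarith)
    have h2 : (v (b + 1) - v x) / (b + 1 - x) ≤ (v (b + 1) - v b) / (b + 1 - b) := by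
      have := hv.secant_mono (a := b + 1) (x := x) (y := b) (mem_Ioi.2 (by linarith)) hx hb
        (by linarith) (by linarith) hxb
      rw [← neg_sub (v (b + 1)) (v x), ← neg_sub (b + 1) x, neg_div_neg_eq,
        ← neg_sub (v (b + 1)) (v b), ← neg_sub (b + 1) b, neg_div_neg_eq] at this
      exact this
    rw [add_sub_cancel_left, div_one] at h2
    have h3 := (h1.trans h2).trans (le_max_right 0 _)
    rwa [div_le_iff₀ (sub_pos.2 hyx)] at h3
  · exact ⟨0, le_rfl, fun x y hy hyx hxb => absurd (hy.trans (hyx.trans_le hxb)) hb⟩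

/-! ### Young functions and their inverses -/

namespace IsNiceYoung

variable {Φ : ℝ → ℝ}

theorem map_zero (h : IsNiceYoung Φ) : Φ 0 = 0 := (h.eq_zero_iff 0).2 rfl

theorem pos (h : IsNiceYoung Φ) {x : ℝ} (hx : x ≠ 0) : 0 < Φ x := by
  have h1 := h.convex.2 (mem_univ x) (mem_univ (-x))
    (show (0 : ℝ) ≤ 1 / 2 by norm_num) (show (0 : ℝ) ≤ 1 / 2 by norm_num) (by norm_num)
  simp only [smul_eq_mul, h.even] at h1
  rw [show (1 / 2 : ℝ) * x + 1 / 2 * -x = 0 by ring, h.map_zero] at h1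
  have h2 : Φ x ≠ 0 := fun h0 => hx ((h.eq_zero_iff x).1 h0)
  exact lt_of_le_of_ne (by linarith) h2.symm

theorem nonneg (h : IsNiceYoung Φ) (x : ℝ) : 0 ≤ Φ x := by
  rcases eq_or_ne x 0 with rfl | hx
  · exact h.map_zero.ge
  · exact (h.pos hx).le

theorem abs (h : IsNiceYoung Φ) (x : ℝ) : Φ |x| = Φ x := by
  rcases abs_choice x with h1 | h1 <;> rw [h1]
  exact h.even x

theorem strictMonoOn (h : IsNiceYoung Φ) : StrictMonoOn Φ (Ici 0) := by
  intro x hx y _ hxy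
  have hx : 0 ≤ x := hx
  have hy : 0 < y := hx.trans_lt hxy
  have h1 := h.convex.2 (mem_univ y) (mem_univ 0)
    (div_nonneg hx hy.le) (sub_nonneg.2 ((div_le_one hy).2 hxy.le)) (by ring)
  simp only [smul_eq_mul, h.map_zero, mul_zero, add_zero, div_mul_cancel₀ _ hy.ne'] at h1
  have h2 : x / y * Φ y < 1 * Φ y :=
    mul_lt_mul_of_pos_right ((div_lt_one hy).2 hxy) (h.pos hy.ne')
  linarith

theorem exists_le_add (h : IsNiceYoung Φ) : ∃ C, 0 ≤ C ∧ ∀ x, 0 ≤ x → x ≤ C + Φ x := by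
  obtain ⟨N, hN⟩ := eventually_atTop.1 (h.tendsto_atTop.eventually_ge_atTop 1)
  refine ⟨max N 0, le_max_right _ _, fun x hx => ?_⟩
  rcases le_or_gt x (max N 0) with h1 | h1
  · linarith [h.nonneg x]
  · have h2 := hN x ((le_max_left _ _).trans h1.le)
    have h3 : 0 < x := (le_max_right _ _).trans_lt h1
    rw [le_div_iff₀ h3, one_mul] at h2
    linarith [le_max_right N 0]

theorem exists_eq (h : IsNiceYoung Φ) {y : ℝ} (hy : 0 ≤ y) : ∃ x ∈ Ici (0 : ℝ), Φ x = y := by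
  obtain ⟨C, hC, hle⟩ := h.exists_le_add
  have h1 := hle (C + y) (by positivity)
  obtain ⟨x, hx, hxy⟩ := intermediate_value_Icc (a := 0) (b := C + y) (by positivity)
    h.continuous.continuousOn (show y ∈ Icc _ _ from ⟨by rwa [h.map_zero], by linarith⟩)
  exact ⟨x, hx.1, hxy⟩

end IsNiceYoung

/-- The inverse on `[0, ∞)` of a Young function. -/
def youngInv (Φ : ℝ → ℝ) : ℝ → ℝ := Function.invFunOn Φ (Ici 0)

namespace IsNiceYoung

variable {Φ : ℝ → ℝ}

theorem youngInv_nonneg (h : IsNiceYoung Φ) {y : ℝ} (hy : 0 ≤ y) : 0 ≤ youngInv Φ y :=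
  Function.invFunOn_mem (h.exists_eq hy)

theorem apply_youngInv (h : IsNiceYoung Φ) {y : ℝ} (hy : 0 ≤ y) : Φ (youngInv Φ y) = y :=
  Function.invFunOn_eq (h.exists_eq hy)

theorem youngInv_apply (h : IsNiceYoung Φ) {x : ℝ} (hx : 0 ≤ x) : youngInv Φ (Φ x) = x :=
  h.strictMonoOn.injOn (h.youngInv_nonneg (h.nonneg x)) hx (h.apply_youngInv (h.nonneg x))

theorem youngInv_mono (h : IsNiceYoung Φ) : MonotoneOn (youngInv Φ) (Ici 0) := by
  intro y hy y' hy' hle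
  refine (h.strictMonoOn.le_iff_le (h.youngInv_nonneg hy) (h.youngInv_nonneg hy')).1 ?_
  rwa [h.apply_youngInv hy, h.apply_youngInv hy']

end IsNiceYoung

/-! ### The reparametrisation `Φ₀⁻¹ ∘ Ψ_θ` -/

/-- The map `ρ_θ` with `Φ₀ (ρ_θ x) = T_θ (Φ₀ x)`, where `T` is the flow of `y' = y F(y)`. -/
def reparam (F Φ₀ : ℝ → ℝ) (θ x : ℝ) : ℝ := youngInv Φ₀ (flow F θ (Φ₀ x))

/-- The vector field whose flow is `reparam`. -/
def reparamField (F Φ₀ : ℝ → ℝ) (y : ℝ) : ℝ := Φ₀ y / deriv Φ₀ y * F (Φ₀ y)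

namespace IsStandardData

variable {F Φ₀ lam : ℝ → ℝ}

theorem flow_nonneg (h : IsStandardData F Φ₀ lam) {y θ : ℝ} (hy : 0 ≤ y) (hθ : 0 ≤ θ) :
    0 ≤ flow F θ y := by
  rcases hy.eq_or_lt with rfl | hy
  · rw [flow_zero_right]
  · exact (h.flow_pos hy hθ).le

theorem contDiffAt_young (h : IsStandardData F Φ₀ lam) {x : ℝ} (hx : 0 < x) :
    ContDiffAt ℝ 2 Φ₀ x := h.Φ₀_contDiff.contDiffAt (Ioi_mem_nhds hx)

theorem differentiableAt_young (h : IsStandardData F Φ₀ lam) {x : ℝ} (hx : 0 < x) :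
    DifferentiableAt ℝ Φ₀ x := (h.contDiffAt_young hx).differentiableAt (by norm_num)

theorem deriv_young_pos (h : IsStandardData F Φ₀ lam) {x : ℝ} (hx : 0 < x) :
    0 < deriv Φ₀ x := by
  have h1 := h.young.convex.slope_le_of_hasDerivAt (mem_univ 0) (mem_univ x) hx
    (h.differentiableAt_young hx).hasDerivAt
  rw [slope_def_field, h.young.map_zero, sub_zero, sub_zero] at h1
  exact (div_pos (h.young.pos hx.ne') hx).trans_le h1

theorem differentiableAt_deriv_young (h : IsStandardData F Φ₀ lam) {x : ℝ} (hx : 0 < x) :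
    DifferentiableAt ℝ (deriv Φ₀) x := by
  have h1 : ContDiffOn ℝ 1 (deriv Φ₀) (Ioi 0) :=
    h.Φ₀_contDiff.deriv_of_isOpen isOpen_Ioi (by norm_num)
  exact (h1.contDiffAt (Ioi_mem_nhds hx)).differentiableAt (by norm_num)

theorem differentiableAt_F (h : IsStandardData F Φ₀ lam) {x : ℝ} (hx : 0 < x) :
    DifferentiableAt ℝ F x :=
  (h.F_contDiff.contDiffAt (Ioi_mem_nhds hx)).differentiableAt (by norm_num)

theorem hasDerivAt_reparamField (h : IsStandardData F Φ₀ lam) {x : ℝ} (hx : 0 < x) :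
    HasDerivAt (reparamField F Φ₀)
      (deriv (fun y => Φ₀ y / deriv Φ₀ y) x * F (Φ₀ x) + Φ₀ x * deriv F (Φ₀ x)) x := by
  have hd := h.deriv_young_pos hx
  have h1 : DifferentiableAt ℝ (fun y => Φ₀ y / deriv Φ₀ y) x :=
    (h.differentiableAt_young hx).fun_div (h.differentiableAt_deriv_young hx) hd.ne'
  have h2 := (h.differentiableAt_F (h.young.pos hx.ne')).hasDerivAt.comp x
    (h.differentiableAt_young hx).hasDerivAt
  refine (h1.hasDerivAt.mul h2).congr_deriv ?_
  simp only [Function.comp_apply]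
  field_simp

/-- The factor `Φ₀'` from the chain rule cancels, so the derivative of the field is exactly the
negative of the function that `antitone` makes non-increasing. -/
theorem convexOn_reparamField (h : IsStandardData F Φ₀ lam) :
    ConvexOn ℝ (Ioi 0) (reparamField F Φ₀) := by
  refine MonotoneOn.convexOn_of_deriv (convex_Ioi 0)
    (fun x hx => (h.hasDerivAt_reparamField hx).continuousAt.continuousWithinAt) ?_ ?_
  · rw [interior_Ioi]
    exact fun x hx => (h.hasDerivAt_reparamField hx).differentiableAt.differentiableWithinAt
  · rw [interior_Ioi]
    intro x hx y hy hxy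
    rw [(h.hasDerivAt_reparamField hx).deriv, (h.hasDerivAt_reparamField hy).deriv]
    have := h.antitone hx hy hxy
    simp only at this
    linarith

theorem apply_reparam (h : IsStandardData F Φ₀ lam) {θ : ℝ} (hθ : 0 ≤ θ) (x : ℝ) :
    Φ₀ (reparam F Φ₀ θ x) = flow F θ (Φ₀ x) :=
  h.young.apply_youngInv (h.flow_nonneg (h.young.nonneg x) hθ)

theorem reparam_nonneg (h : IsStandardData F Φ₀ lam) {θ : ℝ} (hθ : 0 ≤ θ) (x : ℝ) :
    0 ≤ reparam F Φ₀ θ x :=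
  h.young.youngInv_nonneg (h.flow_nonneg (h.young.nonneg x) hθ)

theorem reparam_pos (h : IsStandardData F Φ₀ lam) {θ x : ℝ} (hθ : 0 ≤ θ) (hx : 0 < x) :
    0 < reparam F Φ₀ θ x := by
  refine lt_of_le_of_ne (h.reparam_nonneg hθ x) fun h0 => ?_
  have h1 := h.apply_reparam hθ x
  rw [← h0, h.young.map_zero] at h1
  exact (h.flow_pos (h.young.pos hx.ne') hθ).ne h1

theorem reparam_zero_right (h : IsStandardData F Φ₀ lam) (θ : ℝ) : reparam F Φ₀ θ 0 = 0 := by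
  rw [reparam, h.young.map_zero, flow_zero_right]
  nth_rw 1 [← h.young.map_zero]
  exact h.young.youngInv_apply le_rfl

theorem reparam_zero_left (h : IsStandardData F Φ₀ lam) {x : ℝ} (hx : 0 ≤ x) :
    reparam F Φ₀ 0 x = x := by
  rw [reparam, h.flow_zero_left (h.young.nonneg x), h.young.youngInv_apply hx]

theorem reparam_mono (h : IsStandardData F Φ₀ lam) {θ : ℝ} (hθ : 0 ≤ θ) :
    MonotoneOn (reparam F Φ₀ θ) (Ici 0) := fun x hx y hy hxy =>
  h.young.youngInv_mono (h.flow_nonneg (h.young.nonneg x) hθ)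
    (h.flow_nonneg (h.young.nonneg y) hθ) (h.flow_mono hθ (h.young.nonneg x) (h.young.nonneg y)
      (h.young.strictMonoOn.monotoneOn hx hy hxy))

theorem reparam_le (h : IsStandardData F Φ₀ lam) {θ x : ℝ} (hθ : 0 ≤ θ) (hx : 0 ≤ x)
    (hx1 : Φ₀ x ≤ 1) : reparam F Φ₀ θ x ≤ x := by
  rcases hx.eq_or_lt with rfl | hx
  · rw [h.reparam_zero_right]
  · refine (h.young.strictMonoOn.le_iff_le (h.reparam_nonneg hθ x) hx.le).1 ?_
    rw [h.apply_reparam hθ]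
    exact h.flow_le (h.young.pos hx.ne') hx1 hθ

theorem hasDerivAt_reparam (h : IsStandardData F Φ₀ lam) {θ x : ℝ} (hθ : 0 ≤ θ) (hx : 0 < x) :
    HasDerivAt (fun θ => reparam F Φ₀ θ x) (reparamField F Φ₀ (reparam F Φ₀ θ x)) θ := by
  have hp := h.reparam_pos hθ hx
  have h1 := hasDerivAt_invFunOn (Ici_mem_nhds hp) h.young.strictMonoOn.injOn
    ((h.contDiffAt_young hp).hasStrictDerivAt (by norm_num)) (h.deriv_young_pos hp).ne'
  rw [h.apply_reparam hθ] at h1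
  refine (h1.comp θ (h.hasDerivAt_flow (h.young.pos hx.ne') hθ)).congr_deriv ?_
  rw [reparamField, h.apply_reparam hθ, div_eq_inv_mul, mul_assoc]

/-- A convex scalar field has a flow convex in the initial value: the combination `z` of two
trajectories satisfies `z' ≥ v(z)`, while `u` solves `u' = v(u)` from the same starting point, so `u
≤ z`. -/
theorem convexOn_reparam_Ioi (h : IsStandardData F Φ₀ lam) {θ : ℝ} (hθ : 0 ≤ θ) :
    ConvexOn ℝ (Ioi 0) (reparam F Φ₀ θ) := by
  refine ⟨convex_Ioi 0, fun x hx y hy a b ha hb hab => ?_⟩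
  have hw : 0 < a * x + b * y := (convex_Ioi (0 : ℝ)) hx hy ha hb hab
  simp only [smul_eq_mul]
  set u : ℝ → ℝ := fun s => reparam F Φ₀ s (a * x + b * y) with hu
  set z : ℝ → ℝ := fun s => a * reparam F Φ₀ s x + b * reparam F Φ₀ s y with hz
  have hud : ∀ s, 0 ≤ s → HasDerivAt u (reparamField F Φ₀ (u s)) s :=
    fun s hs => h.hasDerivAt_reparam hs hw
  have hzd : ∀ s, 0 ≤ s → HasDerivAt z (a * reparamField F Φ₀ (reparam F Φ₀ s x) +
      b * reparamField F Φ₀ (reparam F Φ₀ s y)) s := fun s hs =>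
    ((h.hasDerivAt_reparam hs hx).const_mul a).add ((h.hasDerivAt_reparam hs hy).const_mul b)
  have huc : ContinuousOn u (Icc 0 θ) :=
    fun s hs => (hud s hs.1).continuousAt.continuousWithinAt
  have hzc : ContinuousOn z (Icc 0 θ) :=
    fun s hs => (hzd s hs.1).continuousAt.continuousWithinAt
  obtain ⟨M, hM⟩ := isCompact_Icc.bddAbove_image huc
  obtain ⟨K, hK, hKv⟩ := convexOn_exists_sub_le h.convexOn_reparamField M
  have hzpos : ∀ s, 0 ≤ s → 0 < z s := fun s hs =>
    (convex_Ioi (0 : ℝ)) (h.reparam_pos hs hx) (h.reparam_pos hs hy) ha hb hab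
  have := le_add_exp_of_barrier (v := reparamField F Φ₀) (u := u) (z := z) hθ le_rfl huc hzc
    (fun s hs hlt => hKv _ _ (hzpos s hs.1) hlt (hM (mem_image_of_mem _ (Ico_subset_Icc_self hs))))
    (fun s hs => ⟨u, _, (hud s hs.1).hasDerivWithinAt, rfl, Eventually.of_forall fun _ => le_rfl,
      le_rfl⟩)
    (fun s hs => ⟨_, (hzd s hs.1).hasDerivWithinAt,
      h.convexOn_reparamField.2 (h.reparam_pos hs.1 hx) (h.reparam_pos hs.1 hy) ha hb hab⟩)
    (by
      simp only [hu, hz, h.reparam_zero_left (le_of_lt hw), h.reparam_zero_left (le_of_lt hx),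
        h.reparam_zero_left (le_of_lt hy), add_zero, le_refl])
  simpa only [zero_mul, add_zero] using this

/-- Convexity is carried to the endpoint `0` by replacing `0` with a small `δ` such that `Φ₀ δ ≤ 1`.
There the flow decreases, so `ρ_θ(δ) ≤ δ`. -/
theorem reparam_mul_le (h : IsStandardData F Φ₀ lam) {θ c x : ℝ} (hθ : 0 ≤ θ) (hc : 0 ≤ c)
    (hc1 : c ≤ 1) (hx : 0 ≤ x) : reparam F Φ₀ θ (c * x) ≤ c * reparam F Φ₀ θ x := by
  rcases hx.eq_or_lt with rfl | hx
  · simp [h.reparam_zero_right]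
  obtain ⟨x₁, hx₁, hx₁1⟩ := h.young.exists_eq (zero_le_one (α := ℝ))
  have hx₁0 : 0 < x₁ := by
    refine lt_of_le_of_ne hx₁ fun h0 => ?_
    rw [← h0, h.young.map_zero] at hx₁1
    exact zero_ne_one hx₁1
  refine le_of_forall_pos_le_add fun η hη => ?_
  set δ := min x₁ η with hδ
  have hδ0 : 0 < δ := lt_min hx₁0 hη
  have h1 := (h.convexOn_reparam_Ioi hθ).2 (mem_Ioi.2 hx) (mem_Ioi.2 hδ0) hc (sub_nonneg.2 hc1)
    (by ring)
  simp only [smul_eq_mul] at h1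
  have h2 : reparam F Φ₀ θ δ ≤ δ := h.reparam_le hθ hδ0.le
    (hx₁1 ▸ h.young.strictMonoOn.monotoneOn hδ0.le hx₁0.le (min_le_left _ _))
  have h3 : (1 - c) * reparam F Φ₀ θ δ ≤ 1 * η := by
    refine mul_le_mul (by linarith) (h2.trans (min_le_right _ _)) (h.reparam_nonneg hθ _) zero_le_one
  have h4 : 0 ≤ (1 - c) * δ := mul_nonneg (sub_nonneg.2 hc1) hδ0.le
  have h5 : reparam F Φ₀ θ (c * x) ≤ reparam F Φ₀ θ (c * x + (1 - c) * δ) :=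
    h.reparam_mono hθ (mem_Ici.2 (by positivity)) (mem_Ici.2 (by positivity)) (by linarith)
  linarith

theorem convexOn_reparam (h : IsStandardData F Φ₀ lam) {θ : ℝ} (hθ : 0 ≤ θ) :
    ConvexOn ℝ (Ici 0) (reparam F Φ₀ θ) := by
  refine ⟨convex_Ici 0, fun x hx y hy a b ha hb hab => ?_⟩
  rcases (mem_Ici.1 hx).eq_or_lt with rfl | hx'
  · simp only [smul_eq_mul, mul_zero, zero_add, h.reparam_zero_right]
    exact h.reparam_mul_le hθ hb (by linarith) hy
  rcases (mem_Ici.1 hy).eq_or_lt with rfl | hy'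
  · simp only [smul_eq_mul, mul_zero, add_zero, h.reparam_zero_right]
    exact h.reparam_mul_le hθ ha (by linarith) hx
  exact (h.convexOn_reparam_Ioi hθ).2 hx' hy' ha hb hab

/-- Convexity gives continuity in the interior only; at `0` the squeeze `0 ≤ ρ_θ(x) ≤ x` is used. -/
theorem continuousOn_reparam (h : IsStandardData F Φ₀ lam) {θ : ℝ} (hθ : 0 ≤ θ) :
    ContinuousOn (reparam F Φ₀ θ) (Ici 0) := by
  intro x hx
  rcases (mem_Ici.1 hx).eq_or_lt with rfl | hx'
  · have h1 : ∀ᶠ x in 𝓝[≥] (0 : ℝ), Φ₀ x < 1 := by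
      refine (h.young.continuous.continuousAt.eventually_lt continuousAt_const ?_).filter_mono
        nhdsWithin_le_nhds
      rw [h.young.map_zero]; exact one_pos
    rw [ContinuousWithinAt, h.reparam_zero_right]
    refine squeeze_zero' (Eventually.of_forall fun x => h.reparam_nonneg hθ x) ?_
      (tendsto_nhdsWithin_of_tendsto_nhds tendsto_id)
    filter_upwards [h1, self_mem_nhdsWithin] with x hx1 hx2
    exact h.reparam_le hθ hx2 hx1.le
  · have h1 := (h.convexOn_reparam hθ).continuousOn_interior
    rw [interior_Ici] at h1
    exact (h1.continuousAt (Ioi_mem_nhds hx')).continuousWithinAt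

/-! ### The members of a standard Orlicz family -/

theorem flow_young_eq (h : IsStandardData F Φ₀ lam) {θ : ℝ} (hθ : 0 ≤ θ) (x : ℝ) :
    flow F θ (Φ₀ x) = Φ₀ (reparam F Φ₀ θ x) := (h.apply_reparam hθ x).symm

theorem continuousOn_flow_young (h : IsStandardData F Φ₀ lam) {θ : ℝ} (hθ : 0 ≤ θ) :
    ContinuousOn (fun x => flow F θ (Φ₀ x)) (Ici 0) := by
  simp only [h.flow_young_eq hθ]
  exact h.young.continuous.comp_continuousOn (h.continuousOn_reparam hθ)

theorem continuous_flow_young (h : IsStandardData F Φ₀ lam) {θ : ℝ} (hθ : 0 ≤ θ) :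
    Continuous (fun x => flow F θ (Φ₀ x)) := by
  have : (fun x => flow F θ (Φ₀ x)) = fun x => flow F θ (Φ₀ |x|) := by
    simp only [h.young.abs]
  rw [this]
  exact (h.continuousOn_flow_young hθ).comp_continuous continuous_abs fun x => abs_nonneg x

theorem flow_young_nonneg (h : IsStandardData F Φ₀ lam) {θ : ℝ} (hθ : 0 ≤ θ) (x : ℝ) :
    0 ≤ flow F θ (Φ₀ x) := h.flow_nonneg (h.young.nonneg x) hθ

theorem monotoneOn_flow_young (h : IsStandardData F Φ₀ lam) {θ : ℝ} (hθ : 0 ≤ θ) :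
    MonotoneOn (fun x => flow F θ (Φ₀ x)) (Ici 0) := fun x hx y hy hxy =>
  h.flow_mono hθ (h.young.nonneg x) (h.young.nonneg y) (h.young.strictMonoOn.monotoneOn hx hy hxy)

theorem convexOn_flow_young (h : IsStandardData F Φ₀ lam) {θ : ℝ} (hθ : 0 ≤ θ) :
    ConvexOn ℝ (Ici 0) (fun x => flow F θ (Φ₀ x)) := by
  refine ⟨convex_Ici 0, fun x hx y hy a b ha hb hab => ?_⟩
  simp only [h.flow_young_eq hθ]
  refine le_trans ?_ (h.young.convex.2 (mem_univ _) (mem_univ _) ha hb hab)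
  refine h.young.strictMonoOn.monotoneOn (h.reparam_nonneg hθ _) ?_
    ((h.convexOn_reparam hθ).2 hx hy ha hb hab)
  exact (convex_Ici (0 : ℝ)) (h.reparam_nonneg hθ _) (h.reparam_nonneg hθ _) ha hb hab

theorem flow_young_mul_le (h : IsStandardData F Φ₀ lam) {θ c x : ℝ} (hθ : 0 ≤ θ) (hc : 0 ≤ c)
    (hc1 : c ≤ 1) (hx : 0 ≤ x) : flow F θ (Φ₀ (c * x)) ≤ c * flow F θ (Φ₀ x) := by
  have h1 := (h.convexOn_flow_young hθ).2 hx (mem_Ici.2 (le_refl (0 : ℝ))) hc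
    (sub_nonneg.2 hc1) (by ring)
  simpa only [smul_eq_mul, mul_zero, add_zero, h.young.map_zero, flow_zero_right] using h1

/-- Where `Φ₀ ≥ 1` the flow only increases it. The bound makes functions of finite modular
integrable, so that kernels act on them by genuine integrals. -/
theorem exists_le_add_flow_young (h : IsStandardData F Φ₀ lam) {θ : ℝ} (hθ : 0 ≤ θ) :
    ∃ C, 0 ≤ C ∧ ∀ x, 0 ≤ x → x ≤ C + flow F θ (Φ₀ x) := by
  obtain ⟨C, hC, hle⟩ := h.young.exists_le_add
  refine ⟨C + 1, by positivity, fun x hx => ?_⟩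
  have h1 := hle x hx
  rcases le_total (Φ₀ x) 1 with h2 | h2
  · linarith [h.flow_young_nonneg hθ x]
  · linarith [h.le_flow h2 hθ]

/-! ### Comparison of two families -/

/-- Trajectories separate at most by the factor `exp (K Θ)`, where `K` is a one-sided Lipschitz
constant of `w F(w)` below the maximum of the trajectory started at `Y`. Uniformity in `θ` yields
joint continuity of the flow. -/
theorem exists_lipschitz_flow (h : IsStandardData F Φ₀ lam) {Θ Y : ℝ} (hY : 1 ≤ Y) :
    ∃ C, ∀ θ ∈ Icc 0 Θ, ∀ y ∈ Ioc 0 Y, ∀ y' ∈ Ioc 0 Y,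
      |flow F θ y - flow F θ y'| ≤ C * |y - y'| := by
  have hY0 : 0 < Y := one_pos.trans_le hY
  have hc : ContinuousOn (fun θ => flow F θ Y) (Icc 0 Θ) :=
    fun s hs => (h.hasDerivAt_flow hY0 hs.1).continuousAt.continuousWithinAt
  obtain ⟨M, hM⟩ := isCompact_Icc.bddAbove_image hc
  obtain ⟨K, hK, hKv⟩ := convexOn_exists_sub_le h.F_convex M
  have key : ∀ θ ∈ Icc 0 Θ, ∀ y ∈ Ioc 0 Y, ∀ y' ∈ Ioc 0 Y,
      flow F θ y - flow F θ y' ≤ Real.exp (K * Θ) * |y - y'| := by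
    intro θ hθ y hy y' hy'
    have hcy : ∀ w ∈ Ioc 0 Y, ContinuousOn (fun s => flow F s w) (Icc 0 θ) := fun w hw s hs =>
      (h.hasDerivAt_flow hw.1 hs.1).continuousAt.continuousWithinAt
    have h1 := le_add_exp_of_barrier (v := fun w => w * F w) (u := fun s => flow F s y)
      (z := fun s => flow F s y') (δ := |y - y'|) hθ.1 (abs_nonneg _) (hcy y hy) (hcy y' hy')
      (fun s hs hlt => hKv _ _ (h.flow_pos hy'.1 hs.1) hlt
        ((h.flow_mono hs.1 hy.1.le hY0.le hy.2).trans
          (hM (mem_image_of_mem (fun θ => flow F θ Y) ⟨hs.1, hs.2.le.trans hθ.2⟩))))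
      (fun s hs => ⟨fun s => flow F s y, _, (h.hasDerivAt_flow hy.1 hs.1).hasDerivWithinAt, rfl,
        Eventually.of_forall fun _ => le_rfl, le_rfl⟩)
      (fun s hs => ⟨_, (h.hasDerivAt_flow hy'.1 hs.1).hasDerivWithinAt, le_rfl⟩)
      (by
        simp only [h.flow_zero_left hy.1.le, h.flow_zero_left hy'.1.le]
        linarith [le_abs_self (y - y')])
    have h2 : Real.exp (K * θ) ≤ Real.exp (K * Θ) :=
      Real.exp_le_exp.2 (mul_le_mul_of_nonneg_left hθ.2 hK)
    have h3 := mul_le_mul_of_nonneg_left h2 (abs_nonneg (y - y'))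
    linarith
  refine ⟨Real.exp (K * Θ), fun θ hθ y hy y' hy' => abs_le.2 ⟨?_, key θ hθ y hy y' hy'⟩⟩
  have := key θ hθ y' hy' y hy
  rw [abs_sub_comm y' y] at this
  linarith

theorem continuousOn_uncurry_flow (h : IsStandardData F Φ₀ lam) :
    ContinuousOn (fun p : ℝ × ℝ => flow F p.1 p.2) (Ici 0 ×ˢ Ioi 0) := by
  rintro ⟨θ, y⟩ ⟨hθ, hy⟩
  simp only [mem_Ici, mem_Ioi] at hθ hy
  obtain ⟨C, hC⟩ := h.exists_lipschitz_flow (Θ := θ + 1) (Y := y + 1)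
    (by linarith)
  rw [ContinuousWithinAt, tendsto_iff_dist_tendsto_zero]
  have h1 : Tendsto (fun p : ℝ × ℝ => C * |p.2 - y| + |flow F p.1 y - flow F θ y|)
      (𝓝[Ici 0 ×ˢ Ioi 0] (θ, y)) (𝓝 0) := by
    have h2 : ContinuousAt (fun p : ℝ × ℝ => C * |p.2 - y| + |flow F p.1 y - flow F θ y|)
        (θ, y) := by
      have h3 : ContinuousAt (fun p : ℝ × ℝ => flow F p.1 y) (θ, y) :=
        ContinuousAt.comp (g := fun s => flow F s y) (f := Prod.fst)
          (h.hasDerivAt_flow hy hθ).continuousAt continuousAt_fst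
      fun_prop
    have := h2.tendsto
    simp only [sub_self, abs_zero, mul_zero, add_zero] at this
    exact this.mono_left nhdsWithin_le_nhds
  refine squeeze_zero' (Eventually.of_forall fun _ => dist_nonneg) ?_ h1
  have h4 : ∀ᶠ p : ℝ × ℝ in 𝓝 (θ, y), p.1 < θ + 1 ∧ p.2 < y + 1 :=
    (continuousAt_fst.eventually_lt continuousAt_const (by simp)).and
      (continuousAt_snd.eventually_lt continuousAt_const (by simp))
  filter_upwards [self_mem_nhdsWithin, nhdsWithin_le_nhds h4] with p hp hp'
  rw [Real.dist_eq]
  have h5 := hC p.1 ⟨hp.1, hp'.1.le⟩ p.2 ⟨hp.2, hp'.2.le⟩ y ⟨hy, by linarith⟩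
  have h6 := abs_sub_le (flow F p.1 p.2) (flow F p.1 y) (flow F θ y)
  linarith

/-- If `F̃ ≤ ε F + d`, an exponential contraction of the argument turns the flow of `y F̃(y)`
into the flow of `ε y F(y)`. -/
theorem flow_young_exp_le {Ft lamt : ℝ → ℝ} (h : IsStandardData F Φ₀ lam)
    (ht : IsStandardData Ft Φ₀ lamt) {ε d : ℝ} (hε : 0 ≤ ε) (hd : 0 ≤ d)
    (hle : ∀ x, 0 < x → Ft x ≤ ε * F x + d) {θ r x : ℝ} (hθ : 0 ≤ θ) (hr : 0 ≤ r) (hx : 0 ≤ x) :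
    flow Ft (θ + r) (Φ₀ (Real.exp (-(d * r)) * x)) ≤ flow F (ε * r) (flow Ft θ (Φ₀ x)) := by
  rcases hx.eq_or_lt with rfl | hx
  · simp [h.young.map_zero, flow_zero_right]
  set u : ℝ → ℝ := fun s => flow Ft (θ + s) (Φ₀ (Real.exp (-(d * s)) * x)) with hu
  set z : ℝ → ℝ := fun s => flow F (ε * s) (flow Ft θ (Φ₀ x)) with hz
  have hy : 0 < flow Ft θ (Φ₀ x) := ht.flow_pos (h.young.pos hx.ne') hθ
  have hzd : ∀ s, 0 ≤ s → HasDerivAt z (ε * (z s * F (z s))) s := by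
    intro s hs
    have h1 := h.hasDerivAt_flow hy (mul_nonneg hε hs)
    refine (h1.comp s ((hasDerivAt_id s).const_mul ε)).congr_deriv ?_
    simp only [mul_one, hz]; ring
  have hxp : ∀ s, 0 < Real.exp (-(d * s)) * x := fun s => by positivity
  have huc : ContinuousOn u (Icc 0 r) := by
    refine ht.continuousOn_uncurry_flow.comp (f := fun s => (θ + s, Φ₀ (Real.exp (-(d * s)) * x)))
      ?_ ?_
    · have := h.young.continuous
      fun_prop
    · exact fun s hs => ⟨mem_Ici.2 (add_nonneg hθ hs.1), h.young.pos (hxp s).ne'⟩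
  have hzc : ContinuousOn z (Icc 0 r) := fun s hs => (hzd s hs.1).continuousAt.continuousWithinAt
  obtain ⟨M, hM⟩ := isCompact_Icc.bddAbove_image huc
  obtain ⟨K, hK, hKv⟩ := convexOn_exists_sub_le (h.F_convex.smul hε) M
  have := le_add_exp_of_barrier (v := fun w => ε * (w * F w)) (u := u) (z := z) hr le_rfl huc hzc
    (fun s hs hlt => hKv _ _ (h.flow_pos hy (mul_nonneg hε hs.1)) hlt
      (hM (mem_image_of_mem _ (Ico_subset_Icc_self hs)))) ?_
    (fun s hs => ⟨_, (hzd s hs.1).hasDerivWithinAt, le_rfl⟩)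
    (by simp only [hu, hz, mul_zero, add_zero, neg_zero, Real.exp_zero, one_mul,
      h.flow_zero_left hy.le, le_refl])
  · simpa only [zero_mul, add_zero] using this
  intro s hs
  have hθs : 0 ≤ θ + s := add_nonneg hθ hs.1
  set y := Real.exp (-(d * s)) * x with hydef
  have hy0 : 0 < y := hxp s
  have hw : 0 < u s := ht.flow_pos (h.young.pos hy0.ne') hθs
  -- This comparison function freezes the argument at `y` and moves the contraction outside the
  -- flow. It dominates `u` for `t > s` because a convex function vanishing at `0` satisfies `Ψ(c y)
  -- ≤ c Ψ(y)`. Its slope at `s` is `u (F̃(u) - d) ≤ ε u F(u)`.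
  refine ⟨fun t => Real.exp (-(d * (t - s))) * flow Ft (θ + t) (Φ₀ y),
    -d * u s + u s * Ft (u s), ?_, ?_, ?_, ?_⟩
  · have h1 : HasDerivAt (fun t => Real.exp (-(d * (t - s)))) (-d) s := by
      have := ((((hasDerivAt_id s).sub_const s).const_mul d).neg).exp
      refine this.congr_deriv ?_
      simp
    have h2 := (ht.hasDerivAt_flow (h.young.pos hy0.ne') hθs).comp_const_add θ s
    refine ((h1.mul h2).congr_deriv ?_).hasDerivWithinAt
    simp only [sub_self, mul_zero, neg_zero, Real.exp_zero, one_mul]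
    rfl
  · simp only [sub_self, mul_zero, neg_zero, Real.exp_zero, one_mul]
    rfl
  · filter_upwards [self_mem_nhdsWithin] with t hst
    have hst : s < t := hst
    have h1 := ht.flow_young_mul_le (θ := θ + t) (c := Real.exp (-(d * (t - s)))) (x := y)
      (by linarith) (Real.exp_pos _).le
      (Real.exp_le_one_iff.2 (neg_nonpos.2 (mul_nonneg hd (sub_nonneg.2 hst.le)))) hy0.le
    refine le_trans (le_of_eq ?_) h1
    simp only [hu, hydef]
    rw [← mul_assoc, ← Real.exp_add]
    ring_nf
  · have h1 := mul_le_mul_of_nonneg_left (hle _ hw) hw.le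
    linarith

end IsStandardData

/-! ### Markov kernels with an invariant measure -/

section Kernels

variable {E : Type*} [MeasurableSpace E] {μ : Measure E} {κ : Kernel E E}

theorem lintegral_lintegral_of_invariant (hκ : κ.Invariant μ) {f : E → ℝ≥0∞}
    (hf : AEMeasurable f μ) : ∫⁻ x, ∫⁻ y, f y ∂(κ x) ∂μ = ∫⁻ x, f x ∂μ := by
  have hκ : μ.bind κ = μ := hκ
  rw [← Measure.lintegral_bind κ.measurable.aemeasurable (by rwa [hκ]), hκ]

theorem ae_ae_of_invariant (hκ : κ.Invariant μ) {p : E → Prop} (hp : ∀ᵐ y ∂μ, p y) :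
    ∀ᵐ x ∂μ, ∀ᵐ y ∂(κ x), p y := by
  have hκ : μ.bind κ = μ := hκ
  exact Measure.ae_ae_of_ae_comp (by rwa [hκ])

theorem ae_integrable_of_invariant (hκ : κ.Invariant μ) {f : E → ℝ} (hf : Integrable f μ) :
    ∀ᵐ x ∂μ, Integrable f (κ x) := by
  have hκ : μ.bind κ = μ := hκ
  exact Measure.ae_integrable_of_integrable_comp (by rwa [hκ])

theorem act_congr_ae (hκ : κ.Invariant μ) {f g : E → ℝ} (h : f =ᵐ[μ] g) :
    act κ f =ᵐ[μ] act κ g := by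
  filter_upwards [ae_ae_of_invariant hκ h] with x hx
  exact integral_congr_ae hx

theorem aemeasurable_act (hκ : κ.Invariant μ) {f : E → ℝ} (hf : AEMeasurable f μ) :
    AEMeasurable (act κ f) μ :=
  ((hf.measurable_mk.stronglyMeasurable.integral_kernel (κ := κ)).measurable.aemeasurable).congr
    (act_congr_ae hκ hf.ae_eq_mk).symm

theorem act_comp_ae {η : Kernel E E} (h : (η ∘ₖ κ).Invariant μ) {f : E → ℝ}
    (hf : Integrable f μ) : act (η ∘ₖ κ) f =ᵐ[μ] act κ (act η f) := by
  filter_upwards [ae_integrable_of_invariant h hf] with x hx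
  exact Kernel.integral_comp hx

theorem lintegral_ofReal_congr_ae {f g : E → ℝ} (h : f =ᵐ[μ] g) (Ψ : ℝ → ℝ) (a : ℝ) :
    ∫⁻ x, ENNReal.ofReal (Ψ (|f x| / a)) ∂μ = ∫⁻ x, ENNReal.ofReal (Ψ (|g x| / a)) ∂μ := by
  refine lintegral_congr_ae ?_
  filter_upwards [h] with x hx
  rw [hx]

/-- Jensen's inequality for a non-decreasing convex function of the absolute value. -/
theorem map_abs_integral_div_le [IsProbabilityMeasure μ] {G : ℝ → ℝ} (hG : ConvexOn ℝ (Ici 0) G)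
    (hGc : ContinuousOn G (Ici 0)) (hGm : MonotoneOn G (Ici 0)) {f : E → ℝ} {a : ℝ} (ha : 0 < a)
    (hf : Integrable f μ) (hGf : Integrable (fun x => G (|f x| / a)) μ) :
    G (|∫ x, f x ∂μ| / a) ≤ ∫ x, G (|f x| / a) ∂μ := by
  have h1 : |∫ x, f x ∂μ| / a ≤ ∫ x, |f x| / a ∂μ := by
    rw [integral_div]
    exact div_le_div_of_nonneg_right (abs_integral_le_integral_abs) ha.le
  have h2 := hG.map_integral_le hGc isClosed_Ici (f := fun x => |f x| / a) (μ := μ)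
    (Eventually.of_forall fun x => mem_Ici.2 (by positivity)) (hf.abs.div_const a) hGf
  refine (hGm (mem_Ici.2 (by positivity)) (mem_Ici.2 ?_) h1).trans h2
  exact integral_nonneg fun x => by positivity

theorem integrable_of_lintegral_le_one [IsFiniteMeasure μ] {Ψ : ℝ → ℝ} {C : ℝ}
    (hC : ∀ x, 0 ≤ x → x ≤ C + Ψ x) (hΨc : Continuous Ψ) (hΨ0 : ∀ x, 0 ≤ Ψ x) {f : E → ℝ}
    (hf : AEMeasurable f μ) {a : ℝ} (ha : 0 < a)
    (h : ∫⁻ x, ENNReal.ofReal (Ψ (|f x| / a)) ∂μ ≤ 1) :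
    Integrable (fun x => Ψ (|f x| / a)) μ ∧ Integrable f μ := by
  have h1 : Integrable (fun x => Ψ (|f x| / a)) μ := by
    refine (lintegral_ofReal_ne_top_iff_integrable ?_ (Eventually.of_forall fun x => hΨ0 _)).1
      (ne_top_of_le_ne_top ENNReal.one_ne_top h)
    exact (hΨc.measurable.comp_aemeasurable
      ((measurable_abs.comp_aemeasurable hf).div_const a)).aestronglyMeasurable
  refine ⟨h1, ?_⟩
  have h2 : Integrable (fun x => a * (C + Ψ (|f x| / a))) μ :=
    ((integrable_const C).add h1).const_mul a
  refine h2.mono' hf.aestronglyMeasurable (Eventually.of_forall fun x => ?_)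
  have h3 := hC (|f x| / a) (by positivity)
  rwa [div_le_iff₀ ha, mul_comm] at h3

/-- Orlicz modulars do not increase under a Markov kernel with invariant measure. -/
theorem lintegral_act_le [IsMarkovKernel κ] (hκ : κ.Invariant μ) {Ψ : ℝ → ℝ}
    (hΨ : ConvexOn ℝ (Ici 0) Ψ) (hΨc : Continuous Ψ) (hΨm : MonotoneOn Ψ (Ici 0))
    (hΨ0 : ∀ x, 0 ≤ Ψ x) {f : E → ℝ} {a : ℝ} (ha : 0 < a) (hf : Integrable f μ)
    (hΨf : Integrable (fun x => Ψ (|f x| / a)) μ) :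
    ∫⁻ x, ENNReal.ofReal (Ψ (|act κ f x| / a)) ∂μ ≤ ∫⁻ x, ENNReal.ofReal (Ψ (|f x| / a)) ∂μ := by
  rw [← lintegral_lintegral_of_invariant hκ hΨf.aemeasurable.ennreal_ofReal]
  refine lintegral_mono_ae ?_
  filter_upwards [ae_integrable_of_invariant hκ hf, ae_integrable_of_invariant hκ hΨf]
    with x hx hx'
  rw [← ofReal_integral_eq_lintegral_ofReal hx' (Eventually.of_forall fun _ => hΨ0 _)]
  exact ENNReal.ofReal_le_ofReal (map_abs_integral_div_le hΨ hΨc.continuousOn hΨm ha hx hx')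

end Kernels

/-! ### Luxembourg norms -/

section Norms

variable {E : Type*} [MeasurableSpace E] {μ : Measure E}

theorem luxNorm_le {Ψ : ℝ → ℝ} {f : E → ℝ} {a : ℝ} (ha : 0 < a)
    (h : ∫⁻ x, ENNReal.ofReal (Ψ (|f x| / a)) ∂μ ≤ 1) : luxNorm μ Ψ f ≤ ENNReal.ofReal a :=
  sInf_le ⟨a, ha, rfl, h⟩

/-- Every scale `b > 1` is admissible by monotonicity; Fatou along `b ↓ 1` makes the scale `1`
admissible. -/
theorem lintegral_le_one_of_luxNorm_le_one {Ψ : ℝ → ℝ} (hΨc : Continuous Ψ)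
    (hΨm : MonotoneOn Ψ (Ici 0)) {f : E → ℝ} (hf : AEMeasurable f μ) (h : luxNorm μ Ψ f ≤ 1) :
    ∫⁻ x, ENNReal.ofReal (Ψ |f x|) ∂μ ≤ 1 := by
  have h1 : ∀ b : ℝ, 1 < b → ∫⁻ x, ENNReal.ofReal (Ψ (|f x| / b)) ∂μ ≤ 1 := by
    intro b hb
    have hlt : luxNorm μ Ψ f < ENNReal.ofReal b :=
      h.trans_lt (by rwa [← ENNReal.ofReal_one, ENNReal.ofReal_lt_ofReal_iff (one_pos.trans hb)])
    obtain ⟨_, ⟨a, ha, rfl, hle⟩, hab⟩ := sInf_lt_iff.1 hlt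
    rw [ENNReal.ofReal_lt_ofReal_iff (one_pos.trans hb)] at hab
    refine (lintegral_mono fun x => ENNReal.ofReal_le_ofReal ?_).trans hle
    exact hΨm (mem_Ici.2 (by positivity)) (mem_Ici.2 (by positivity))
      (div_le_div_of_nonneg_left (abs_nonneg _) ha hab.le)
  obtain ⟨b, -, hb, hb1⟩ := exists_seq_strictAnti_tendsto (1 : ℝ)
  have h2 : ∀ x, Tendsto (fun k => ENNReal.ofReal (Ψ (|f x| / b k))) atTop
      (𝓝 (ENNReal.ofReal (Ψ |f x|))) := by
    intro x
    refine ENNReal.tendsto_ofReal ((hΨc.tendsto _).comp ?_)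
    have := (tendsto_const_nhds (x := |f x|)).div hb1 one_ne_zero
    rwa [div_one] at this
  calc ∫⁻ x, ENNReal.ofReal (Ψ |f x|) ∂μ
      = ∫⁻ x, liminf (fun k => ENNReal.ofReal (Ψ (|f x| / b k))) atTop ∂μ :=
        lintegral_congr fun x => (h2 x).liminf_eq.symm
    _ ≤ liminf (fun k => ∫⁻ x, ENNReal.ofReal (Ψ (|f x| / b k)) ∂μ) atTop := by
        refine lintegral_liminf_le' fun k => ?_
        exact (hΨc.measurable.comp_aemeasurable
          ((measurable_abs.comp_aemeasurable hf).div_const (b k))).ennreal_ofReal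
    _ ≤ 1 := by
        refine liminf_le_of_le ?_ fun c hc => ?_
        · isBoundedDefault
        · obtain ⟨k, hk⟩ := hc.exists
          exact hk.trans (h1 _ (hb k))

end Norms

/-! ### Hypercontractivity along a standard Orlicz family -/

section Hypercontractivity

variable {E : Type*} [MeasurableSpace E] {μ : Measure E} [IsProbabilityMeasure μ]
  {F Ft Φ₀ lam lamt : ℝ → ℝ}

/-- One application of a kernel which improves integrability from `Φ₀` to `T_σ ∘ Φ₀`. -/
theorem lintegral_flow_act_le_one {κ : Kernel E E} [IsMarkovKernel κ] (hκ : κ.Invariant μ)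
    (hF : IsStandardData F Φ₀ lam) (hFt : IsStandardData Ft Φ₀ lamt) {ε d θ r : ℝ} (hε : 0 ≤ ε)
    (hd : 0 ≤ d) (hle : ∀ x, 0 < x → Ft x ≤ ε * F x + d) (hθ : 0 ≤ θ) (hr : 0 ≤ r)
    (hyp : ∀ g, MemOrlicz μ Φ₀ g →
      luxNorm μ (fun x => flow F (ε * r) (Φ₀ x)) (act κ g) ≤ luxNorm μ Φ₀ g)
    {f : E → ℝ} (hf : AEMeasurable f μ) {a : ℝ} (ha : 0 < a)
    (h : ∫⁻ x, ENNReal.ofReal (flow Ft θ (Φ₀ (|f x| / a))) ∂μ ≤ 1) :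
    ∫⁻ x, ENNReal.ofReal (flow Ft (θ + r) (Φ₀ (|act κ f x| / (a * Real.exp (d * r))))) ∂μ ≤ 1 := by
  have hσ : 0 ≤ ε * r := mul_nonneg hε hr
  obtain ⟨C, -, hC⟩ := hFt.exists_le_add_flow_young hθ
  obtain ⟨C₀, -, hC₀⟩ := hF.young.exists_le_add
  have hfi := (integrable_of_lintegral_le_one (Ψ := fun x => flow Ft θ (Φ₀ x)) hC
    (hFt.continuous_flow_young hθ) (hFt.flow_young_nonneg hθ) hf ha h).2
  -- `Φ₀ ∘ g` equals `T̃_θ(Φ₀(|f|/a))`, so `g` lies in the unit ball for `Φ₀`, where the hypothesis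
  -- applies.
  set g : E → ℝ := fun x => reparam Ft Φ₀ θ (|f x| / a) with hg
  have hg0 : ∀ x, 0 ≤ g x := fun x => hFt.reparam_nonneg hθ _
  have hgm : AEMeasurable g μ := by
    have h1 : Continuous fun y : ℝ => reparam Ft Φ₀ θ (|y| / a) :=
      (hFt.continuousOn_reparam hθ).comp_continuous (by fun_prop)
        fun y => mem_Ici.2 (by positivity)
    exact h1.measurable.comp_aemeasurable hf
  have hg1 : ∫⁻ x, ENNReal.ofReal (Φ₀ (|g x| / 1)) ∂μ ≤ 1 := by
    refine le_trans (le_of_eq (lintegral_congr fun x => ?_)) h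
    rw [div_one, hF.young.abs, hFt.apply_reparam hθ]
  have hgi := (integrable_of_lintegral_le_one hC₀ hF.young.continuous hF.young.nonneg hgm
    one_pos hg1).2
  have hgn : luxNorm μ Φ₀ g ≤ 1 := by
    simpa using luxNorm_le one_pos hg1
  have h2 := lintegral_le_one_of_luxNorm_le_one (hF.continuous_flow_young hσ)
    (hF.monotoneOn_flow_young hσ) (aemeasurable_act hκ hgm)
    ((hyp g ⟨hgm, hgn.trans_lt ENNReal.one_lt_top⟩).trans hgn)
  refine le_trans (lintegral_mono_ae ?_) h2
  filter_upwards [ae_integrable_of_invariant hκ hfi, ae_integrable_of_invariant hκ hgi]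
    with x hx hx'
  refine ENNReal.ofReal_le_ofReal ?_
  -- Jensen for the convex function `ρ_θ` under the probability measure `κ x`.
  have h3 : reparam Ft Φ₀ θ (|act κ f x| / a) ≤ act κ g x :=
    map_abs_integral_div_le (hFt.convexOn_reparam hθ) (hFt.continuousOn_reparam hθ)
      (hFt.reparam_mono hθ) ha hx hx'
  have h4 := hF.flow_young_exp_le hFt hε hd hle hθ hr (x := |act κ f x| / a) (by positivity)
  have h5 : |act κ f x| / (a * Real.exp (d * r)) = Real.exp (-(d * r)) * (|act κ f x| / a) := by
    rw [Real.exp_neg]; field_simp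
  rw [h5]
  refine h4.trans ?_
  rw [← hFt.apply_reparam hθ]
  exact hF.monotoneOn_flow_young hσ (hFt.reparam_nonneg hθ _) (mem_Ici.2 (abs_nonneg _))
    (h3.trans (le_abs_self _))

variable {P : ℝ≥0 → Kernel E E}

omit [IsProbabilityMeasure μ] in
theorem act_add_ae (hinv : ∀ t, (P t).Invariant μ) (hadd : ∀ s t, P (s + t) = P s ∘ₖ P t)
    {f : E → ℝ} (hf : Integrable f μ) (s t : ℝ≥0) :
    act (P (s + t)) f =ᵐ[μ] act (P t) (act (P s) f) := by
  rw [hadd]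
  exact act_comp_ae (by rw [← hadd]; exact hinv _) hf

/-- The modular form of contractivity on every member of the family. -/
theorem lintegral_flow_act_le_one_of_le_one {κ : Kernel E E} [IsMarkovKernel κ]
    (hκ : κ.Invariant μ) (hF : IsStandardData F Φ₀ lam) {θ : ℝ} (hθ : 0 ≤ θ) {f : E → ℝ}
    (hf : AEMeasurable f μ) {a : ℝ} (ha : 0 < a)
    (h : ∫⁻ x, ENNReal.ofReal (flow F θ (Φ₀ (|f x| / a))) ∂μ ≤ 1) :
    ∫⁻ x, ENNReal.ofReal (flow F θ (Φ₀ (|act κ f x| / a))) ∂μ ≤ 1 := by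
  obtain ⟨C, -, hC⟩ := hF.exists_le_add_flow_young hθ
  obtain ⟨h1, h2⟩ := integrable_of_lintegral_le_one (Ψ := fun x => flow F θ (Φ₀ x)) hC
    (hF.continuous_flow_young hθ) (hF.flow_young_nonneg hθ) hf ha h
  exact (lintegral_act_le hκ (hF.convexOn_flow_young hθ) (hF.continuous_flow_young hθ)
    (hF.monotoneOn_flow_young hθ) (hF.flow_young_nonneg hθ) ha h2 h1).trans h

/-- Iterating the improvement over `N` equal time steps. -/
theorem lintegral_flow_act_nsmul_le_one (hmarkov : ∀ t, IsMarkovKernel (P t))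
    (hzero : P 0 = Kernel.id) (hadd : ∀ s t, P (s + t) = P s ∘ₖ P t)
    (hinv : ∀ t, (P t).Invariant μ)
    (hF : IsStandardData F Φ₀ lam) (hFt : IsStandardData Ft Φ₀ lamt) {ε d θ r : ℝ} (hε : 0 ≤ ε)
    (hd : 0 ≤ d) (hle : ∀ x, 0 < x → Ft x ≤ ε * F x + d) (hθ : 0 ≤ θ) (hr : 0 ≤ r) {τ : ℝ≥0}
    (hyp : ∀ g, MemOrlicz μ Φ₀ g →
      luxNorm μ (fun x => flow F (ε * r) (Φ₀ x)) (act (P τ) g) ≤ luxNorm μ Φ₀ g)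
    {f : E → ℝ} (hf : AEMeasurable f μ) {a : ℝ} (ha : 0 < a)
    (h : ∫⁻ x, ENNReal.ofReal (flow Ft θ (Φ₀ (|f x| / a))) ∂μ ≤ 1) (N : ℕ) :
    ∫⁻ x, ENNReal.ofReal (flow Ft (θ + N * r)
      (Φ₀ (|act (P (N * τ)) f x| / (a * Real.exp (d * (N * r)))))) ∂μ ≤ 1 := by
  obtain ⟨C, -, hC⟩ := hFt.exists_le_add_flow_young hθ
  have hfi := (integrable_of_lintegral_le_one (Ψ := fun x => flow Ft θ (Φ₀ x)) hC
    (hFt.continuous_flow_young hθ) (hFt.flow_young_nonneg hθ) hf ha h).2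
  induction N with
  | zero =>
    -- Integration against a Dirac mass is evaluated on a measurable representative, whence equality
    -- almost everywhere only.
    have h0 : act (P 0) f =ᵐ[μ] f := by
      have hfm := act_congr_ae (hinv 0) hf.ae_eq_mk
      have h1 : act (P 0) (hf.mk f) = hf.mk f := by
        ext x
        rw [act, hzero, Kernel.id_apply,
          integral_dirac' _ _ hf.measurable_mk.stronglyMeasurable]
      rw [h1] at hfm
      exact hfm.trans hf.ae_eq_mk.symm
    simp only [Nat.cast_zero, zero_mul, mul_zero, add_zero, Real.exp_zero, mul_one]
    rw [lintegral_ofReal_congr_ae h0 (fun x => flow Ft θ (Φ₀ x)) a]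
    exact h
  | succ N ih =>
    have := hmarkov τ
    have h1 := lintegral_flow_act_le_one (hinv τ) hF hFt hε hd hle (θ := θ + N * r)
      (by positivity) hr hyp (aemeasurable_act (hinv _) hf) (by positivity) ih
    have h2 : θ + N * r + r = θ + (N + 1 : ℕ) * r := by push_cast; ring
    have h3 : a * Real.exp (d * (N * r)) * Real.exp (d * r) =
        a * Real.exp (d * ((N + 1 : ℕ) * r)) := by
      rw [mul_assoc, ← Real.exp_add]; push_cast; ring_nf
    have h4 : ((N + 1 : ℕ) : ℝ≥0) * τ = N * τ + τ := by push_cast; ring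
    rw [h2, h3] at h1
    rw [h4, lintegral_ofReal_congr_ae (act_add_ae hinv hadd hfi _ _)
      (fun x => flow Ft (θ + (N + 1 : ℕ) * r) (Φ₀ x))]
    exact h1

end Hypercontractivity

/-! ### The convex antitone regularisation of the defect function -/

/-- The constants `d` with `Ft ≤ ε' F + d` for some `ε' ≤ ε`. -/
def defectSet (F Ft : ℝ → ℝ) (ε : ℝ) : Set ℝ :=
  {d | 0 ≤ d ∧ ∃ ε', 0 < ε' ∧ ε' ≤ ε ∧ ∀ x, 0 < x → Ft x ≤ ε' * F x + d}

/-- The least defect over all `ε' ≤ ε`. -/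
def defect (F Ft : ℝ → ℝ) (ε : ℝ) : ℝ := sInf (defectSet F Ft ε)

section Defect

variable {F Ft D : ℝ → ℝ}

theorem bddBelow_defectSet (F Ft : ℝ → ℝ) (ε : ℝ) : BddBelow (defectSet F Ft ε) :=
  ⟨0, fun _ hd => hd.1⟩

theorem mem_defectSet (hD : ∀ ε, 0 < ε → 0 ≤ D ε ∧ ∀ x, 0 < x → Ft x ≤ ε * F x + D ε) {ε : ℝ}
    (hε : 0 < ε) : D ε ∈ defectSet F Ft ε :=
  ⟨(hD ε hε).1, ε, hε, le_rfl, (hD ε hε).2⟩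

theorem defect_le (hD : ∀ ε, 0 < ε → 0 ≤ D ε ∧ ∀ x, 0 < x → Ft x ≤ ε * F x + D ε) {ε : ℝ}
    (hε : 0 < ε) : defect F Ft ε ≤ D ε :=
  csInf_le (bddBelow_defectSet F Ft ε) (mem_defectSet hD hε)

theorem antitoneOn_defect
    (hD : ∀ ε, 0 < ε → 0 ≤ D ε ∧ ∀ x, 0 < x → Ft x ≤ ε * F x + D ε) :
    AntitoneOn (defect F Ft) (Ioi 0) := fun _ h₁ ε₂ _ hle =>
  csInf_le_csInf (bddBelow_defectSet F Ft ε₂) ⟨_, mem_defectSet hD h₁⟩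
    fun _ ⟨hd, ε', h0, h1, h2⟩ => ⟨hd, ε', h0, h1.trans hle, h2⟩

/-- Convex combinations of the inequalities `F̃ ≤ ε₁ F + d₁` and `F̃ ≤ ε₂ F + d₂` are again of this
form. -/
theorem convexOn_defect
    (hD : ∀ ε, 0 < ε → 0 ≤ D ε ∧ ∀ x, 0 < x → Ft x ≤ ε * F x + D ε) :
    ConvexOn ℝ (Ioi 0) (defect F Ft) := by
  refine ⟨convex_Ioi 0, fun x hx y hy a b ha hb hab => le_of_forall_pos_le_add fun η hη => ?_⟩
  obtain ⟨d₁, ⟨hd₁, ε₁, h₁, hle₁, hF₁⟩, hlt₁⟩ := exists_lt_of_csInf_lt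
    ⟨_, mem_defectSet hD hx⟩ (lt_add_of_pos_right (defect F Ft x) hη)
  obtain ⟨d₂, ⟨hd₂, ε₂, h₂, hle₂, hF₂⟩, hlt₂⟩ := exists_lt_of_csInf_lt
    ⟨_, mem_defectSet hD hy⟩ (lt_add_of_pos_right (defect F Ft y) hη)
  simp only [smul_eq_mul]
  have hmem : a * d₁ + b * d₂ ∈ defectSet F Ft (a * x + b * y) := by
    refine ⟨by positivity, a * ε₁ + b * ε₂, (convex_Ioi (0 : ℝ)) h₁ h₂ ha hb hab, by gcongr, ?_⟩
    intro w hw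
    have e1 := mul_le_mul_of_nonneg_left (hF₁ w hw) ha
    have e2 := mul_le_mul_of_nonneg_left (hF₂ w hw) hb
    have e3 : Ft w = a * Ft w + b * Ft w := by rw [← add_mul, hab, one_mul]
    linarith
  have h1 : defect F Ft (a * x + b * y) ≤ a * d₁ + b * d₂ :=
    csInf_le (bddBelow_defectSet F Ft _) hmem
  have h2 := mul_le_mul_of_nonneg_left hlt₁.le ha
  have h3 := mul_le_mul_of_nonneg_left hlt₂.le hb
  have h4 : a * η + b * η = η := by rw [← add_mul, hab, one_mul]
  linarith

end Defect

/-- An antitone convex function on `(0, ∞)` has supporting lines of nonpositive slope. -/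
theorem exists_supporting_line {K : ℝ → ℝ} (hK : ConvexOn ℝ (Ioi 0) K) (hKa : AntitoneOn K (Ioi 0))
    {x : ℝ} (hx : 0 < x) : ∃ m ≤ 0, ∀ y, 0 < y → K x + m * (y - x) ≤ K y := by
  have hxi : x ∈ interior (Ioi (0 : ℝ)) := by rwa [interior_Ioi]
  refine ⟨derivWithin K (Ioi x) x, ?_, fun y hy => ?_⟩
  · have hx1 : (0 : ℝ) < x + 1 := by positivity
    have h1 := hK.rightDeriv_le_slope_of_mem_interior hxi (mem_Ioi.2 hx1) (lt_add_one x)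
    have h2 := hKa hx hx1 (le_add_of_nonneg_right zero_le_one)
    rw [slope_def_field, add_sub_cancel_left, div_one] at h1
    linarith
  · rcases lt_trichotomy x y with h | rfl | h
    · have h1 := hK.rightDeriv_le_slope_of_mem_interior hxi hy h
      rw [slope_def_field, le_div_iff₀ (sub_pos.2 h)] at h1
      linarith
    · simp
    · have h1 := (hK.slope_le_leftDeriv_of_mem_interior hy hxi h).trans
        (hK.leftDeriv_le_rightDeriv_of_mem_interior hxi)
      rw [slope_def_field, div_le_iff₀ (sub_pos.2 h)] at h1
      linarith

/-- Jensen's inequality for the perspective `(g, c) ↦ g K(c / g)` of a convex function, with a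
lower integral on the right. -/
theorem ofReal_mul_le_lintegral {K D R g : ℝ → ℝ} {t c : ℝ} (ht : 0 < t) (hc : 0 < c)
    (hK : ConvexOn ℝ (Ioi 0) K) (hKa : AntitoneOn K (Ioi 0)) (hKD : ∀ ε, 0 < ε → K ε ≤ D ε)
    (hRc : ContinuousOn R (Icc 0 t)) (hR : ∀ u ∈ Ioo 0 t, HasDerivAt R (g u) u)
    (hg : ∀ u ∈ Ioo 0 t, 0 ≤ g u) (hr : 0 < R t - R 0) :
    ENNReal.ofReal ((R t - R 0) * K (c * t / (R t - R 0))) ≤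
      ∫⁻ u in Icc 0 t, ENNReal.ofReal (g u * D (c / g u)) := by
  set r := R t - R 0 with hrdef
  have hε : 0 < c * t / r := by positivity
  obtain ⟨m, hm, hline⟩ := exists_supporting_line hK hKa hε
  -- The derivative `g` need not be continuous; its sign gives integrability.
  have hgi := intervalIntegral.integrableOn_deriv_of_nonneg hRc hR hg
  have hgint : ∫ u in Ioc 0 t, g u = r := by
    rw [← intervalIntegral.integral_of_le ht.le]
    exact intervalIntegral.integral_eq_sub_of_hasDerivAt_of_le ht.le hRc hR
      ((intervalIntegrable_iff_integrableOn_Ioc_of_le ht.le).2 hgi)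
  -- `A` is the intercept of the supporting line at `c t / r`. Multiplying that line at `c / g` by
  -- `g` gives the integrable minorant `g A + m c`, whose integral is exactly `r K(c t / r)`.
  set A := K (c * t / r) - m * (c * t / r) with hA
  have hhi : IntegrableOn (fun u => g u * A + m * c) (Ioc 0 t) :=
    (hgi.mul_const A).add (integrable_const _)
  have hhint : ∫ u in Ioc 0 t, (g u * A + m * c) = r * K (c * t / r) := by
    rw [integral_add (hgi.mul_const A) (integrable_const _), integral_mul_const, hgint,
      setIntegral_const, Real.volume_real_Ioc_of_le ht.le, hA, smul_eq_mul]
    field_simp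
    ring
  rw [← hhint]
  calc ENNReal.ofReal (∫ u in Ioc 0 t, (g u * A + m * c))
      ≤ ∫⁻ u in Ioc 0 t, ENNReal.ofReal (g u * A + m * c) := by
        refine ENNReal.ofReal_le_of_le_toReal ?_
        rw [integral_eq_lintegral_pos_part_sub_lintegral_neg_part hhi]
        exact sub_le_self _ ENNReal.toReal_nonneg
    _ = ∫⁻ u in Ioo 0 t, ENNReal.ofReal (g u * A + m * c) :=
        setLIntegral_congr Ioo_ae_eq_Ioc.symm
    _ ≤ ∫⁻ u in Ioo 0 t, ENNReal.ofReal (g u * D (c / g u)) := by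
        refine setLIntegral_mono' measurableSet_Ioo fun u hu => ENNReal.ofReal_le_ofReal ?_
        -- Where `g = 0` the minorant is `m c ≤ 0`: this is where the antitonicity of `K` enters.
        rcases (hg u hu).eq_or_lt with h0 | h0
        · rw [← h0, zero_mul, zero_mul, zero_add]
          exact mul_nonpos_of_nonpos_of_nonneg hm hc.le
        · have hcg : 0 < c / g u := div_pos hc h0
          have h1 := mul_le_mul_of_nonneg_left ((hline _ hcg).trans (hKD _ hcg)) h0.le
          refine le_trans (le_of_eq ?_) h1
          rw [hA]
          field_simp
          ring
    _ ≤ ∫⁻ u in Icc 0 t, ENNReal.ofReal (g u * D (c / g u)) :=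
        lintegral_mono_set Ioo_subset_Icc_self

/-! ### Norm bounds -/

section Main

variable {E : Type*} [MeasurableSpace E] {μ : Measure E}

theorem luxNorm_le_mul_of_modular {Ψ Ψ' : ℝ → ℝ} {f g : E → ℝ} {c : ℝ} (hc : 0 < c)
    (h : ∀ a, 0 < a → ∫⁻ x, ENNReal.ofReal (Ψ (|f x| / a)) ∂μ ≤ 1 →
      ∫⁻ x, ENNReal.ofReal (Ψ' (|g x| / (a * c))) ∂μ ≤ 1) :
    luxNorm μ Ψ' g ≤ luxNorm μ Ψ f * ENNReal.ofReal c := by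
  have hc0 : ENNReal.ofReal c ≠ 0 := (ENNReal.ofReal_pos.2 hc).ne'
  rw [← ENNReal.div_le_iff hc0 ENNReal.ofReal_ne_top]
  refine le_sInf ?_
  rintro _ ⟨a, ha, rfl, hle⟩
  rw [ENNReal.div_le_iff hc0 ENNReal.ofReal_ne_top, ← ENNReal.ofReal_mul ha.le]
  exact luxNorm_le (mul_pos ha hc) (h a ha hle)

variable [IsProbabilityMeasure μ] {F Ft Φ₀ lam : ℝ → ℝ} {P : ℝ≥0 → Kernel E E}

/-- A right derivative at `0` lets `N` equal time steps cover any smaller total slope. -/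
theorem exists_nat_mul_le {c s t : ℝ} (h0 : lam 0 = 0)
    (hd : HasDerivWithinAt lam c (Ici 0) 0) (ht : 0 < t) (hs : s < c * t) :
    ∃ N : ℕ, 0 < N ∧ s / N ≤ lam (t / N) := by
  have h1 : Tendsto (slope lam 0) (𝓝[>] 0) (𝓝 c) :=
    (hasDerivWithinAt_iff_tendsto_slope' self_notMem_Ioi).1 hd.Ioi_of_Ici
  have h2 : Tendsto (fun N : ℕ => t / (N : ℝ)) atTop (𝓝[>] 0) := by
    refine tendsto_nhdsWithin_iff.2 ⟨tendsto_const_div_atTop_nhds_zero_nat t, ?_⟩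
    filter_upwards [eventually_gt_atTop 0] with N hN
    exact div_pos ht (Nat.cast_pos.2 hN)
  have h3 := (h1.comp h2).eventually_const_lt ((div_lt_iff₀ ht).2 hs)
  obtain ⟨N, hN, hN0⟩ := (h3.and (eventually_gt_atTop 0)).exists
  have hNr : (0 : ℝ) < N := Nat.cast_pos.2 hN0
  refine ⟨N, hN0, ?_⟩
  simp only [Function.comp_apply, slope_def_field, h0, sub_zero] at hN
  rw [lt_div_iff₀ (div_pos ht hNr)] at hN
  refine le_of_eq_of_le ?_ hN.le
  field_simp

/-- For large `N` some `τ ≤ t / N` satisfies `λ(τ) = ε r / N`, because `ε r < c t`. The `N` factors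
`exp (d r / N)` multiply to `exp (d r)`, and the unused time `t - N τ` is spent on plain
contractivity at the final level. -/
theorem luxNorm_act_le_mul_exp (hmarkov : ∀ t, IsMarkovKernel (P t))
    (hzero : P 0 = Kernel.id) (hadd : ∀ s t, P (s + t) = P s ∘ₖ P t)
    (hinv : ∀ t, (P t).Invariant μ)
    (hF : IsStandardData F Φ₀ lam) (hFt : IsStandardData Ft Φ₀ lam)
    (hlam : ContinuousOn lam (Ici 0)) {c : ℝ} (hd0 : HasDerivWithinAt lam c (Ici 0) 0)
    (hyp : ∀ (g : E → ℝ) (t : ℝ≥0), MemOrlicz μ Φ₀ g →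
      luxNorm μ (fun x => flow F (lam t) (Φ₀ x)) (act (P t) g) ≤ luxNorm μ Φ₀ g)
    {ε d θ r : ℝ} (hε : 0 < ε) (hd : 0 ≤ d) (hle : ∀ x, 0 < x → Ft x ≤ ε * F x + d)
    (hθ : 0 ≤ θ) (hr : 0 ≤ r) {t : ℝ≥0} (ht : 0 < t) (hεr : ε * r < c * t)
    {f : E → ℝ} (hf : AEMeasurable f μ) :
    luxNorm μ (fun x => flow Ft (θ + r) (Φ₀ x)) (act (P t) f) ≤
      luxNorm μ (fun x => flow Ft θ (Φ₀ x)) f * ENNReal.ofReal (Real.exp (d * r)) := by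
  obtain ⟨N, hN, hNle⟩ := exists_nat_mul_le hF.lam_zero hd0 (NNReal.coe_pos.2 ht) hεr
  have hNr : (0 : ℝ) < N := Nat.cast_pos.2 hN
  obtain ⟨τ, hτ, hτe⟩ := intermediate_value_Icc (a := 0) (b := (t : ℝ) / N) (by positivity)
    (hlam.mono Icc_subset_Ici_self)
    (show ε * r / N ∈ Icc _ _ from ⟨by rw [hF.lam_zero]; positivity, hNle⟩)
  lift τ to ℝ≥0 using hτ.1
  have hτt : (N : ℝ≥0) * τ ≤ t := by
    have h1 := hτ.2
    rw [le_div_iff₀ hNr] at h1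
    rw [← NNReal.coe_le_coe]
    push_cast
    linarith
  obtain ⟨s, rfl⟩ := exists_add_of_le hτt
  refine luxNorm_le_mul_of_modular (Real.exp_pos _) fun a ha h => ?_
  obtain ⟨C, -, hC⟩ := hFt.exists_le_add_flow_young hθ
  have hfi := (integrable_of_lintegral_le_one (Ψ := fun x => flow Ft θ (Φ₀ x)) hC
    (hFt.continuous_flow_young hθ) (hFt.flow_young_nonneg hθ) hf ha h).2
  have h1 := lintegral_flow_act_nsmul_le_one hmarkov hzero hadd hinv hF hFt hε.le hd hle hθ
    (r := r / N) (by positivity) (τ := τ)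
    (fun g hg => by rw [← mul_div_assoc, ← hτe]; exact hyp g τ hg) hf ha h N
  rw [mul_div_cancel₀ _ hNr.ne'] at h1
  have := hmarkov s
  rw [lintegral_ofReal_congr_ae (act_add_ae hinv hadd hfi _ _)
    (fun x => flow Ft (θ + r) (Φ₀ x))]
  exact lintegral_flow_act_le_one_of_le_one (hinv s) hFt (add_nonneg hθ hr)
    (aemeasurable_act (hinv _) hf) (by positivity) h1

end Main

end OrliczHyp

end

/-! ### Optimisation over `ε` and comparison with the integral. -/

theorem mainTheorem7 {n : ℕ} (V : EuclideanSpace ℝ (Fin n) → ℝ) (hV : ContDiff ℝ 2 V)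
    (hμ : IsProbabilityMeasure (OrliczHyp.gibbs V))
    (P : ℝ≥0 → Kernel (EuclideanSpace ℝ (Fin n)) (EuclideanSpace ℝ (Fin n)))
    (hP : OrliczHyp.IsDiffusionSemigroup V P)
    (F Ft Φ₀ lam : ℝ → ℝ)
    (hF : OrliczHyp.IsStandardData F Φ₀ lam) (hFt : OrliczHyp.IsStandardData Ft Φ₀ lam)
    (hlam : DifferentiableOn ℝ lam (Ici 0)) (hlam0 : 0 < derivWithin lam (Ici 0) 0)
    (D : ℝ → ℝ) (hD : ∀ ε, 0 < ε → 0 ≤ D ε ∧ ∀ x, 0 < x → Ft x ≤ ε * F x + D ε)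
    (hyp : ∀ (f : EuclideanSpace ℝ (Fin n) → ℝ) (t : ℝ≥0),
      OrliczHyp.MemOrlicz (OrliczHyp.gibbs V) Φ₀ f →
      OrliczHyp.luxNorm (OrliczHyp.gibbs V) (OrliczHyp.stdOrlicz F Φ₀ lam t)
          (OrliczHyp.act (P t) f)
        ≤ OrliczHyp.luxNorm (OrliczHyp.gibbs V) Φ₀ f)
    (s₁ s₂ : ℝ) (hs₁ : 0 ≤ s₁) (hs₂ : s₁ ≤ s₂) (t : ℝ≥0)
    (q : ℝ → ℝ) (hq : ContDiffOn ℝ 1 q (Ici 0)) (hqmono : MonotoneOn q (Ici 0))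
    (hq0 : q 0 = s₁) (hqt : q t = s₂)
    (f : EuclideanSpace ℝ (Fin n) → ℝ)
    (hf : OrliczHyp.MemOrlicz (OrliczHyp.gibbs V) (OrliczHyp.stdOrlicz Ft Φ₀ lam s₁) f) :
    OrliczHyp.luxNorm (OrliczHyp.gibbs V) (OrliczHyp.stdOrlicz Ft Φ₀ lam s₂)
        (OrliczHyp.act (P t) f)
      ≤ OrliczHyp.luxNorm (OrliczHyp.gibbs V) (OrliczHyp.stdOrlicz Ft Φ₀ lam s₁) f *
        EReal.exp ((∫⁻ u in Icc (0 : ℝ) t, ENNReal.ofReal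
          (derivWithin q (Ici 0) u * derivWithin lam (Ici 0) (q u) *
            D (derivWithin lam (Ici 0) 0 /
              (derivWithin q (Ici 0) u * derivWithin lam (Ici 0) (q u)))) : ℝ≥0∞) : EReal) := by
  have hinv : ∀ t, (P t).Invariant (OrliczHyp.gibbs V) := fun s => by
    have := hP.markov s
    exact (hP.reversible s).invariant
  have hq_nonneg : ∀ u, 0 ≤ u → 0 ≤ q u := fun u hu =>
    (hs₁.trans_eq hq0.symm).trans (hqmono (mem_Ici.2 le_rfl) hu hu)
  have hθ : 0 ≤ lam s₁ := hF.lam_zero ▸ hF.lam_mono (mem_Ici.2 le_rfl) hs₁ hs₁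
  have hmono : lam s₁ ≤ lam s₂ := hF.lam_mono hs₁ (hs₁.trans hs₂) hs₂
  set J : ℝ≥0∞ := ∫⁻ u in Icc (0 : ℝ) t, ENNReal.ofReal
    (derivWithin q (Ici 0) u * derivWithin lam (Ici 0) (q u) *
      D (derivWithin lam (Ici 0) 0 /
        (derivWithin q (Ici 0) u * derivWithin lam (Ici 0) (q u)))) with hJ
  set A := OrliczHyp.luxNorm (OrliczHyp.gibbs V) (OrliczHyp.stdOrlicz Ft Φ₀ lam s₁) f with hA
  -- If `λ(s₁) = λ(s₂)` the two norms coincide, and contractivity suffices since the exponential is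
  -- at least `1`.
  rcases hmono.eq_or_lt with heq | hlt
  · have hcontr : OrliczHyp.luxNorm (OrliczHyp.gibbs V) (OrliczHyp.stdOrlicz Ft Φ₀ lam s₂)
        (OrliczHyp.act (P t) f) ≤ A * ENNReal.ofReal 1 := by
      refine OrliczHyp.luxNorm_le_mul_of_modular one_pos fun a ha h => ?_
      have := hP.markov t
      simp only [OrliczHyp.stdOrlicz_eq_flow, ← heq, mul_one] at h ⊢
      exact OrliczHyp.lintegral_flow_act_le_one_of_le_one (hinv t) hFt hθ hf.1 ha h
    refine hcontr.trans (mul_le_mul_right ?_ _)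
    rw [ENNReal.ofReal_one, ← EReal.exp_zero]
    exact EReal.exp_monotone (EReal.coe_ennreal_nonneg J)
  set r := lam s₂ - lam s₁ with hr
  have hr0 : 0 < r := sub_pos.2 hlt
  have ht : 0 < t := by
    refine pos_iff_ne_zero.2 fun h0 => ?_
    rw [h0, NNReal.coe_zero, hq0] at hqt
    rw [hqt] at hlt
    exact hlt.false
  have ht' : (0 : ℝ) < t := NNReal.coe_pos.2 ht
  set c := derivWithin lam (Ici 0) 0 with hc
  have hbound : ∀ ε, 0 < ε → ε < c * t / r → ∀ d ∈ OrliczHyp.defectSet F Ft ε,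
      OrliczHyp.luxNorm (OrliczHyp.gibbs V) (OrliczHyp.stdOrlicz Ft Φ₀ lam s₂)
        (OrliczHyp.act (P t) f) ≤ A * ENNReal.ofReal (Real.exp (d * r)) := by
    rintro ε hε hεlt d ⟨hd, ε', hε', hle, hFF⟩
    have h1 := OrliczHyp.luxNorm_act_le_mul_exp hP.markov hP.zero hP.add hinv hF hFt
      hlam.continuousOn (hlam 0 (mem_Ici.2 le_rfl)).hasDerivWithinAt hyp hε' hd hFF hθ hr0.le ht
      ((lt_div_iff₀ hr0).1 (hle.trans_lt hεlt)) hf.1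
    rwa [hr, add_sub_cancel] at h1
  have hε₀ : 0 < c * t / r := by positivity
  have hconv := OrliczHyp.convexOn_defect hD
  -- The endpoint `c t / r` is only approached from below; `defect` is continuous there, being
  -- convex on an open interval.
  have hlim : OrliczHyp.luxNorm (OrliczHyp.gibbs V) (OrliczHyp.stdOrlicz Ft Φ₀ lam s₂)
      (OrliczHyp.act (P t) f) ≤
        A * ENNReal.ofReal (Real.exp (OrliczHyp.defect F Ft (c * t / r) * r)) := by
    have h1 : ∀ η > 0, OrliczHyp.luxNorm (OrliczHyp.gibbs V)
        (OrliczHyp.stdOrlicz Ft Φ₀ lam s₂) (OrliczHyp.act (P t) f) ≤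
        A * ENNReal.ofReal (Real.exp ((OrliczHyp.defect F Ft (c * t / r) + η) * r)) := by
      intro η hη
      have hcont : ContinuousAt (OrliczHyp.defect F Ft) (c * t / r) := by
        have h2 := hconv.continuousOn_interior
        rw [interior_Ioi] at h2
        exact h2.continuousAt (Ioi_mem_nhds hε₀)
      have h3 : ∀ᶠ ε in 𝓝[<] (c * t / r),
          OrliczHyp.defect F Ft ε < OrliczHyp.defect F Ft (c * t / r) + η :=
        (hcont.eventually_lt continuousAt_const (lt_add_of_pos_right _ hη)).filter_mono
          nhdsWithin_le_nhds
      have h4 : ∀ᶠ ε in 𝓝[<] (c * t / r), ε ∈ Ioo 0 (c * t / r) := Ioo_mem_nhdsLT hε₀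
      obtain ⟨ε, h5, h6⟩ := (h3.and h4).exists
      obtain ⟨d, hd, hdlt⟩ := exists_lt_of_csInf_lt ⟨_, OrliczHyp.mem_defectSet hD h6.1⟩ h5
      refine (hbound ε h6.1 h6.2 d hd).trans (mul_le_mul_right ?_ _)
      exact ENNReal.ofReal_le_ofReal
        (Real.exp_le_exp.2 (mul_le_mul_of_nonneg_right hdlt.le hr0.le))
    have h2 : Tendsto (fun η => A * ENNReal.ofReal
        (Real.exp ((OrliczHyp.defect F Ft (c * t / r) + η) * r))) (𝓝[>] 0)
        (𝓝 (A * ENNReal.ofReal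
          (Real.exp ((OrliczHyp.defect F Ft (c * t / r) + 0) * r)))) := by
      -- Finiteness of the norm of `f` permits the limit inside the product.
      refine ENNReal.Tendsto.const_mul (ENNReal.tendsto_ofReal ?_) (Or.inr hf.2.ne)
      refine Tendsto.mono_left (Continuous.tendsto ?_ _) nhdsWithin_le_nhds
      fun_prop
    rw [add_zero] at h2
    exact ge_of_tendsto h2 (eventually_mem_nhdsWithin.mono h1)
  have hderiv : ∀ u, 0 ≤ u → HasDerivWithinAt (fun u => lam (q u))
      (derivWithin q (Ici 0) u * derivWithin lam (Ici 0) (q u)) (Ici 0) u := by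
    intro u hu
    have h1 := (hlam (q u) (hq_nonneg u hu)).hasDerivWithinAt
    have h2 := ((hq.differentiableOn (by norm_num)) u hu).hasDerivWithinAt
    have h3 := h1.comp u h2 (fun v hv => hq_nonneg v hv)
    rw [mul_comm] at h3
    exact h3
  have hint : ENNReal.ofReal (r * OrliczHyp.defect F Ft (c * t / r)) ≤ J := by
    have h1 := OrliczHyp.ofReal_mul_le_lintegral (R := fun u => lam (q u))
      (g := fun u => derivWithin q (Ici 0) u * derivWithin lam (Ici 0) (q u)) (D := D) ht' hlam0
      hconv (OrliczHyp.antitoneOn_defect hD) (fun ε hε => OrliczHyp.defect_le hD hε)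
      (fun u hu => ((hderiv u hu.1).mono Icc_subset_Ici_self).continuousWithinAt)
      (fun u hu => (hderiv u hu.1.le).hasDerivAt (Ici_mem_nhds hu.1))
      (fun u _ => mul_nonneg hqmono.derivWithin_nonneg hF.lam_mono.derivWithin_nonneg)
      (by simp only [hq0, hqt]; exact hr0)
    simpa only [hq0, hqt] using h1
  refine hlim.trans (mul_le_mul_right ?_ _)
  rw [← EReal.exp_coe]
  refine EReal.exp_monotone ?_
  rw [mul_comm]
  exact (EReal.coe_le_coe_iff.2 (Real.le_coe_toNNReal _)).trans
    (EReal.coe_ennreal_le_coe_ennreal_iff.2 hint)
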